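/- **Setting.** Let $\mathcal H$ be the real vector space of Hermitian $2\times2$ complex matrices, $\mathcal H_0^+=\{S\in\mathcal H:\det S=0,\ \operatorname{tr}S>0\}$, and let $\mathbb R^{1,3}$ be Minkowski space with coordinates $(T,X,Y,Z)$, inner product $\langle p,p'\rangle=TT'-XX'-YY'-ZZ'$, positive light cone $L^+=\{\langle p,p\rangle=0,\ T>0\}$ and hyperboloid $\mathbb H=\{\langle x,x\rangle=1,\ T>0\}$. A flag in $\mathbb R^{1,3}$ (resp. $\mathcal H$) is a triple $(p,V,o)$ with $p\in L^+$ (resp. $\mathcal H_0^+$), $V$ a $2$-plane spanned by $p$ and a tangent vector $v$ to the cone at $p$, and $o$ an orientation of $V/\mathbb Rp$; it is written $[[p,v]]$ when $o$ is the class of $v$. A horosphere in $\mathbb H$ is a nonempty intersection of $\mathbb H$ with an affine $3$-plane $\Pi=\{\langle x,n\rangle=c\}$, $n\ne0$ lightlike; its centre is the unique ray of $L^+$ that does not meet $\Pi$. Define * $\mathbf F(\kappa)=[[\mathbf f(\kappa),D_\kappa\mathbf f(\mathcal Z(\kappa))]]$ for $0\neq\kappa\in\mathbb C^2$, where $\mathbf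 f(\kappa)=\kappa\kappa^*$ and $\mathcal Z(\alpha,\beta)=(i\overline\beta,-i\overline\alpha)$; * $\mathbf G(S,V,o)=(\mathbf g(S),\mathbf g(V),\mathbf g(o))$, where $\mathbf g\begin{pmatrix}a&b+ci\\b-ci&d\end{pmatrix}=(a+d,2b,2c,a-d)$; * $\mathbf H(p,V,o)=(\mathbf h(p),\,V\cap T\mathbf h(p))$, where $\mathbf h(p)=\{x\in\mathbb H:\langle x,p\rangle=1\}$ and each line $V\cap T_q\mathbf h(p)$ is oriented by $o$; * $\mathbf I$, $\mathbf J$: transport by the isometries $\mathfrak i$, $\mathfrak j$ and their derivatives, where $\mathfrak i(T,X,Y,Z)=\frac1{1+T}(X,Y,Z)$ maps $\mathbb H$ to the unit ball $\mathbb D$, and $\mathfrak j$ maps $\mathbb D$ to the upper half space $\mathbb U=\{(x,y,z):z>0\}$ and extends stereographic projection $(x,y,z)\mapsto\frac{x+iy}{1-z}$ on the spheres at infinity $S^2\to\mathbb C\cup\{\infty\}$, i.e. $\mathfrak j(x,y,z)=\frac{(2x,\,2y,\,1-x^2-y^2-z^2)}{x^2+y^2+(1-z)^2}$. Horospheres in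 $\mathbb U$ are the images of horospheres in $\mathbb H$ under $\mathfrak j\circ\mathfrak i$; their centres are the images in $\mathbb C\cup\{\infty\}$ of the centres in $\mathbb H$ under the extension of $\mathfrak j\circ\mathfrak i$ to infinity, which sends the ray of $(T,X,Y,Z)\in L^+$ to $\frac{X+iY}{T-Z}$. A decorated horosphere is a horosphere with an oriented tangent line field which is parallel, i.e. invariant under those isometries given by parabolic elements (trace $\pm2$) of $SL(2,\mathbb C)$ which preserve the horosphere; here $A\in SL(2,\mathbb C)$ acts on $\mathbb H$ via $S\mapsto ASA^*$ on $\mathcal H\cong\mathbb R^{1,3}$, and on $\mathbb U$ via $\mathfrak j\circ\mathfrak i$. A complex number $a+bi$ specifies a decoration at a point where the tangent plane is horizontal if the vector $(a,b,0)$ directs the oriented line there. Put $\mathbf K=\mathbf J\circ\mathbf I\circ\mathbf H\circ\mathbf G\circ\mathbf F$ and $\mathbf k(\kappa)=\mathfrak j(\mathfrak i(\mathbf h(\mathbf g(\mathbf f(\kappa)))))$. **Theorem.** Let $(\xi,\eta)\in\mathbb C^2\setminus\{(0,0)\}$. Then $\mathbf K(\xi,\eta)$ is a decorated horosphere in $\mathbb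 U$, centred at $\xi/\eta\in\mathbb C\cup\{\infty\}$ (with $\xi/0=\infty$), and: 1. if $\eta\ne0$, its horosphere is the Euclidean sphere of diameter $|\eta|^{-2}$ tangent to $\mathbb C=\{z=0\}$ at $\xi/\eta$ (without the point of tangency), and its decoration is specified at the north pole (highest point) by $i\eta^{-2}$; 2. if $\eta=0$, its horosphere is the horizontal plane at height $|\xi|^2$, and its decoration is specified at every point by $i\xi^2$. The underlying horosphere of $\mathbf K(\xi,\eta)$ is $\mathbf k(\xi,\eta)$. -/

import Mathlib

open Matrix Topology

attribute [local instance] Matrix.normedAddCommGroup Matrix.normedSpace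

noncomputable section

namespace SpinorHorosphere

/-! ### Tangent vectors, oriented null flags, oriented line fields -/

/-- The tangent vectors at `x` of a subset `M` of a normed space: velocities at `x` of curves that
run in `M`. For the submanifolds used below this is the usual tangent space. -/
def tangentVectors {E : Type*} [NormedAddCommGroup E] [NormedSpace ℝ E] (M : Set E) (x : E) :
    Set E :=
  {v | ∃ γ : ℝ → E, γ 0 = x ∧ (∀ᶠ t in 𝓝 (0 : ℝ), γ t ∈ M) ∧ HasDerivAt γ v 0}

/-- The open half-plane `ℝ p + ℝ⁺ v`. -/
def openHalfPlane {E : Type*} [NormedAddCommGroup E] [NormedSpace ℝ E] (p v : E) : Set E :=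
  {w | ∃ a b : ℝ, 0 < b ∧ w = a • p + b • v}

/-- A pointed oriented flag `(p, V, o)` based on a cone `C` (the positive light cone, or the
corresponding cone of Hermitian matrices): `p ∈ C`, `V` is a 2-plane spanned by `p` and a tangent
vector to `C` at `p`, and `o` is an orientation of the line `V / ℝ p`. The orientation is recorded
as the set `pos` of all vectors of `V` whose class in `V / ℝ p` is a positive basis. -/
@[ext]
structure Flag {E : Type*} [NormedAddCommGroup E] [NormedSpace ℝ E] (C : Set E) where
  point : E
  plane : Submodule ℝ E
  pos : Set E
  point_mem : point ∈ C
  exists_rep : ∃ v ∈ tangentVectors C point, LinearIndependent ℝ ![point, v] ∧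
    plane = Submodule.span ℝ {point, v} ∧ pos = openHalfPlane point v

/-- The flag `[[p, v]]`. -/
def Flag.mk' {E : Type*} [NormedAddCommGroup E] [NormedSpace ℝ E] {C : Set E} (p v : E)
    (hp : p ∈ C) (hv : v ∈ tangentVectors C p) (h : LinearIndependent ℝ ![p, v]) : Flag C where
  point := p
  plane := Submodule.span ℝ {p, v}
  pos := openHalfPlane p v
  point_mem := hp
  exists_rep := ⟨v, hv, h, rfl, rfl⟩

/-- A subset `carrier` of a normed space, with a set `dir q` of vectors attached to each point `q`.
An oriented line at `q` is given by the open ray `dir q` of the vectors which direct it. -/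
@[ext]
structure DirectedSet (E : Type*) where
  carrier : Set E
  dir : E → Set E

/-- `dir` is a field of oriented tangent lines along `carrier` (and is empty elsewhere). -/
def DirectedSet.IsOrientedLineField {E : Type*} [NormedAddCommGroup E] [NormedSpace ℝ E]
    (X : DirectedSet E) : Prop :=
  (∀ q ∈ X.carrier, ∃ v ∈ tangentVectors X.carrier q, v ≠ 0 ∧
    X.dir q = {w | ∃ c : ℝ, 0 < c ∧ w = c • v}) ∧
  ∀ q ∉ X.carrier, X.dir q = ∅

/-- Transport by a map and its derivative. -/
def DirectedSet.push {E E' : Type*} [NormedAddCommGroup E] [NormedSpace ℝ E]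
    [NormedAddCommGroup E'] [NormedSpace ℝ E'] (φ : E → E') (X : DirectedSet E) :
    DirectedSet E' where
  carrier := φ '' X.carrier
  dir y := {w | ∃ q ∈ X.carrier, φ q = y ∧ ∃ v ∈ X.dir q, w = fderiv ℝ φ q v}

/-! ### Hermitian matrices -/

/-- The real vector space of Hermitian 2 × 2 complex matrices. -/
abbrev Herm : Type := selfAdjoint.submodule ℝ (Matrix (Fin 2) (Fin 2) ℂ)

/-- Singular Hermitian matrices with positive trace. -/
def hermCone : Set Herm := {S | (S : Matrix (Fin 2) (Fin 2) ℂ).det = 0 ∧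
  0 < (S : Matrix (Fin 2) (Fin 2) ℂ).trace.re}

/-- `f κ = κ κ*`. -/
def f (κ : Fin 2 → ℂ) : Herm :=
  ⟨vecMulVec κ (star κ), by
    change star _ = _
    rw [star_eq_conjTranspose, conjTranspose_vecMulVec, star_star]⟩

/-- `Z (α, β) = (i β̄, - i ᾱ)`. -/
def Z (κ : Fin 2 → ℂ) : Fin 2 → ℂ := ![Complex.I * star (κ 1), -Complex.I * star (κ 0)]

/-- `A · S = A S A*`. -/
def hermAct (A : SpecialLinearGroup (Fin 2) ℂ) (S : Herm) : Herm :=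
  ⟨A.1 * S.1 * A.1ᴴ, by
    have h : S.1ᴴ = S.1 := S.2
    change (_)ᴴ = _
    rw [conjTranspose_mul, conjTranspose_mul, h, conjTranspose_conjTranspose, Matrix.mul_assoc]⟩

/-! ### Minkowski space -/

/-- Minkowski space, with coordinates `(T, X, Y, Z)`. -/
abbrev Mink : Type := Fin 4 → ℝ

/-- The Minkowski inner product. -/
def mink (p q : Mink) : ℝ := p 0 * q 0 - p 1 * q 1 - p 2 * q 2 - p 3 * q 3

/-- The positive light cone. -/
def lightCone : Set Mink := {p | mink p p = 0 ∧ 0 < p 0}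

/-- The linear isomorphism from Hermitian matrices to Minkowski space,
`(a, b + c i; b - c i, d) ↦ (a + d, 2 b, 2 c, a - d)`. -/
def g : Herm ≃ₗ[ℝ] Mink where
  toFun S := ![(S.1 0 0).re + (S.1 1 1).re, 2 * (S.1 0 1).re, 2 * (S.1 0 1).im,
    (S.1 0 0).re - (S.1 1 1).re]
  map_add' S S' := by
    ext i; fin_cases i <;> simp <;> ring
  map_smul' c S := by
    ext i; fin_cases i <;> simp <;> ring
  invFun p := ⟨!![(((p 0 + p 3) / 2 : ℝ) : ℂ), ⟨p 1 / 2, p 2 / 2⟩;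
      ⟨p 1 / 2, -(p 2 / 2)⟩, (((p 0 - p 3) / 2 : ℝ) : ℂ)], by
    change (_)ᴴ = _
    ext i j
    fin_cases i <;> fin_cases j <;> simp [conjTranspose_apply, Complex.ext_iff]⟩
  left_inv S := by
    have h : ∀ i j, star (S.1 j i) = S.1 i j := fun i j => congrFun (congrFun S.2 i) j
    have h0 := congrArg Complex.im (h 0 0)
    have h1 := congrArg Complex.im (h 1 1)
    have h2 := h 1 0
    simp only [RCLike.star_def, Complex.conj_im] at h0 h1
    ext i j
    fin_cases i <;> fin_cases j <;> simp [Complex.ext_iff, ← h2] <;> linarith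
  right_inv p := by
    ext i; fin_cases i <;> simp <;> ring

/-- The action of `SL(2, ℂ)` on Minkowski space. -/
def minkAct (A : SpecialLinearGroup (Fin 2) ℂ) (p : Mink) : Mink := g (hermAct A (g.symm p))

/-! ### From spinors to flags -/

theorem f_mem_hermCone {κ : Fin 2 → ℂ} (hκ : κ ≠ 0) : f κ ∈ hermCone := by
  constructor
  · simp [f, det_fin_two, vecMulVec_apply]
    ring
  · have h : 0 < Complex.normSq (κ 0) + Complex.normSq (κ 1) := by
      by_contra! hc
      have h0 := Complex.normSq_nonneg (κ 0)
      have h1 := Complex.normSq_nonneg (κ 1)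
      apply hκ
      have e0 : κ 0 = 0 := Complex.normSq_eq_zero.1 (by linarith)
      have e1 : κ 1 = 0 := Complex.normSq_eq_zero.1 (by linarith)
      ext i
      fin_cases i
      · exact e0
      · exact e1
    simpa [f, trace_fin_two, vecMulVec_apply, Complex.mul_conj] using h

theorem hasDerivAt_f (κ ν : Fin 2 → ℂ) :
    ∃ D : Herm, (D : Matrix (Fin 2) (Fin 2) ℂ) = vecMulVec κ (star ν) + vecMulVec ν (star κ) ∧
      HasDerivAt (fun t : ℝ => f (κ + t • ν)) D 0 := by
  refine ⟨⟨vecMulVec κ (star ν) + vecMulVec ν (star κ), ?_⟩, rfl, ?_⟩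
  · change (_)ᴴ = _
    rw [conjTranspose_add, conjTranspose_vecMulVec, conjTranspose_vecMulVec, star_star, star_star,
      add_comm]
  · set D : Herm := ⟨vecMulVec κ (star ν) + vecMulVec ν (star κ), _⟩ with hD
    have h : (fun t : ℝ => f (κ + t • ν)) = fun t : ℝ => f κ + t • D + (t ^ 2) • f ν := by
      funext t
      apply Subtype.ext
      ext i j
      simp [f, hD, vecMulVec_apply]
      ring
    rw [h]
    have h1 : HasDerivAt (fun t : ℝ => t • D) D 0 := by
      have := (hasDerivAt_id (0 : ℝ)).smul_const D
      rw [one_smul] at this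
      exact this
    have h2 : HasDerivAt (fun t : ℝ => t ^ 2 • f ν) 0 0 := by
      have := (hasDerivAt_pow 2 (0 : ℝ)).smul_const (f ν)
      simp only [Nat.cast_ofNat, Nat.add_one_sub_one, pow_one, mul_zero, zero_smul] at this
      exact this
    have h3 := (h1.const_add (f κ)).add h2
    rw [add_zero] at h3
    exact h3

theorem lineDeriv_f (κ ν : Fin 2 → ℂ) :
    ((lineDeriv ℝ f κ ν : Herm) : Matrix (Fin 2) (Fin 2) ℂ) =
      vecMulVec κ (star ν) + vecMulVec ν (star κ) := by
  obtain ⟨D, h, hD⟩ := hasDerivAt_f κ ν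
  rw [← h, lineDeriv, hD.deriv]

theorem lineDeriv_f_mem {κ : Fin 2 → ℂ} (hκ : κ ≠ 0) (ν : Fin 2 → ℂ) :
    lineDeriv ℝ f κ ν ∈ tangentVectors hermCone (f κ) := by
  obtain ⟨D, -, hD⟩ := hasDerivAt_f κ ν
  refine ⟨fun t => f (κ + t • ν), by simp, ?_, ?_⟩
  · have hc : Filter.Tendsto (fun t : ℝ => κ + t • ν) (𝓝 0) (𝓝 κ) := by
      have : Continuous fun t : ℝ => κ + t • ν := by fun_prop
      simpa using this.tendsto 0
    filter_upwards [hc.eventually_ne hκ] with t ht using f_mem_hermCone ht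
  · rw [lineDeriv, hD.deriv]
    exact hD

theorem linearIndependent_f {κ : Fin 2 → ℂ} (hκ : κ ≠ 0) :
    LinearIndependent ℝ ![f κ, lineDeriv ℝ f κ (Z κ)] := by
  rw [LinearIndependent.pair_iff]
  intro s t h
  have hN := (f_mem_hermCone hκ).2
  have h' := congrArg (fun S : Herm => (S : Matrix (Fin 2) (Fin 2) ℂ)) h
  simp only [Submodule.coe_add, Submodule.coe_smul, lineDeriv_f, Submodule.coe_zero] at h'
  have e := fun k l => congrFun (congrFun h' k) l
  simp only [f, Matrix.add_apply, Matrix.smul_apply, vecMulVec_apply, Pi.star_apply,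
    Matrix.zero_apply, Complex.real_smul] at e
  have z0 : Z κ 0 = Complex.I * star (κ 1) := rfl
  have z1 : Z κ 1 = -Complex.I * star (κ 0) := rfl
  have e00 := e 0 0
  have e01 := e 0 1
  have e10 := e 1 0
  have e11 := e 1 1
  simp only [z0, z1, star_mul', star_neg, star_star] at e00 e01 e10 e11
  have hI : star Complex.I = -Complex.I := by simp
  rw [hI] at e00 e01 e10 e11
  have hI2 : Complex.I * Complex.I = -1 := Complex.I_mul_I
  have hn : κ 0 * star (κ 0) + κ 1 * star (κ 1) ≠ 0 := by
    intro h0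
    simp only [f, trace_fin_two, vecMulVec_apply, Pi.star_apply] at hN
    rw [h0] at hN
    simp at hN
  have ht : (t : ℂ) * (κ 0 * star (κ 0) + κ 1 * star (κ 1)) ^ 2 = 0 := by
    linear_combination (-Complex.I * κ 1) * (κ 0 * e00 + κ 1 * e01) +
      Complex.I * κ 0 * (κ 0 * e10 + κ 1 * e11) +
      t * (κ 0 * star (κ 0) + κ 1 * star (κ 1)) ^ 2 * hI2
  have ht0 : t = 0 := by
    have := (mul_eq_zero.1 ht).resolve_right (pow_ne_zero 2 hn)
    exact_mod_cast this
  refine ⟨?_, ht0⟩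
  subst ht0
  have hs : (s : ℂ) * (κ 0 * star (κ 0) + κ 1 * star (κ 1)) = 0 := by
    linear_combination e00 + e11
  exact_mod_cast (mul_eq_zero.1 hs).resolve_right hn

/-- The map from nonzero spinors to flags of Hermitian matrices,
`F κ = [[f κ, D_κ f (Z κ)]]`. -/
def F (κ : Fin 2 → ℂ) (hκ : κ ≠ 0) : Flag hermCone :=
  Flag.mk' (f κ) (lineDeriv ℝ f κ (Z κ)) (f_mem_hermCone hκ) (lineDeriv_f_mem hκ _)
    (linearIndependent_f hκ)

theorem g_mem_lightCone {S : Herm} (hS : S ∈ hermCone) : g S ∈ lightCone := by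
  have h : ∀ k l, star (S.1 l k) = S.1 k l := fun k l => congrFun (congrFun S.2 k) l
  have h0 := congrArg Complex.im (h 0 0)
  have h1 := congrArg Complex.im (h 1 1)
  have h2 := h 1 0
  obtain ⟨hd, ht⟩ := hS
  simp only [RCLike.star_def, Complex.conj_im] at h0 h1
  rw [det_fin_two, ← h2] at hd
  have hd' := congrArg Complex.re hd
  simp [trace_fin_two] at hd' ht
  constructor
  · simp [mink, g]
    have e0 : (S.1 0 0).im = 0 := by linarith
    rw [e0] at hd'
    linear_combination 4 * hd'
  · simpa [g] using ht

theorem g_mem_tangentVectors {S U : Herm} (h : U ∈ tangentVectors hermCone S) :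
    g U ∈ tangentVectors lightCone (g S) := by
  obtain ⟨γ, h0, hm, hd⟩ := h
  refine ⟨fun t => g (γ t), congrArg g h0, hm.mono fun t ht => g_mem_lightCone ht, ?_⟩
  have := (g.toContinuousLinearEquiv : Herm →L[ℝ] Mink).hasFDerivAt.comp_hasDerivAt 0 hd
  exact this

/-- The map on flags induced by `g`. -/
def G (Φ : Flag hermCone) : Flag lightCone where
  point := g Φ.point
  plane := Φ.plane.map (g : Herm →ₗ[ℝ] Mink)
  pos := g '' Φ.pos
  point_mem := g_mem_lightCone Φ.point_mem
  exists_rep := by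
    obtain ⟨v, hv, hli, hpl, hpos⟩ := Φ.exists_rep
    refine ⟨g v, g_mem_tangentVectors hv, ?_, ?_, ?_⟩
    · rw [LinearIndependent.pair_iff] at hli ⊢
      intro s t h
      exact hli s t (g.injective (by simpa using h))
    · rw [hpl, Submodule.map_span, Set.image_pair]
      rfl
    · rw [hpos]
      ext w
      constructor
      · rintro ⟨_, ⟨a, b, hb, rfl⟩, rfl⟩
        exact ⟨a, b, hb, by simp⟩
      · rintro ⟨a, b, hb, rfl⟩
        exact ⟨_, ⟨a, b, hb, rfl⟩, by simp⟩

/-! ### The hyperboloid model -/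

/-- The hyperboloid model of hyperbolic 3-space. -/
def hyperboloid : Set Mink := {x | mink x x = 1 ∧ 0 < x 0}

/-- Affine 3-planes with a lightlike normal vector. -/
def IsLightlikePlane (P : Set Mink) : Prop :=
  ∃ n : Mink, n ≠ 0 ∧ mink n n = 0 ∧ ∃ c : ℝ, P = {x | mink x n = c}

/-- Horospheres in the hyperboloid model. -/
def IsHorosphereHyp (s : Set Mink) : Prop :=
  s.Nonempty ∧ ∃ P, IsLightlikePlane P ∧ s = hyperboloid ∩ P

/-- The centre of a horosphere cut out by the lightlike plane `P`: the unique ray of the positive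
light cone, represented here by a point `p` on it, which does not meet `P`. -/
def IsCentreHyp (s : Set Mink) (p : Mink) : Prop :=
  s.Nonempty ∧ p ∈ lightCone ∧ ∃ P, IsLightlikePlane P ∧ s = hyperboloid ∩ P ∧
    ∀ p' ∈ lightCone, (∀ t : ℝ, 0 < t → t • p' ∉ P) ↔ SameRay ℝ p' p

/-- The horosphere of a point of the positive light cone. -/
def h (p : Mink) : Set Mink := {x | x ∈ hyperboloid ∧ mink x p = 1}

/-- The map from flags to horospheres with oriented line fields: at a point `q` of `h p` the line is
`V ∩ T_q (h p)`, oriented by `o`. -/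
def H (Φ : Flag lightCone) : DirectedSet Mink where
  carrier := h Φ.point
  dir q := {w | q ∈ h Φ.point ∧ w ∈ Φ.plane ∧ w ∈ tangentVectors (h Φ.point) q ∧ w ∈ Φ.pos}

/-! ### The disc model and the upper half space model -/

/-- Euclidean 3-space. -/
abbrev E3 : Type := EuclideanSpace ℝ (Fin 3)

/-- The disc model, with the metric `4 |dx|² / (1 - |x|²)²`. -/
def disc : Set E3 := {x | ‖x‖ < 1}

/-- The upper half space model, with the metric `|dx|² / z²`. -/
def upper : Set E3 := {x | 0 < x 2}

/-- The isometry from the hyperboloid to the disc, `(T, X, Y, Z) ↦ (X, Y, Z) / (1 + T)`. -/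
def i (q : Mink) : E3 := !₂[q 1 / (1 + q 0), q 2 / (1 + q 0), q 3 / (1 + q 0)]

/-- The inverse of `i`. -/
def iInv (x : E3) : Mink :=
  ![(1 + ‖x‖ ^ 2) / (1 - ‖x‖ ^ 2), 2 * x 0 / (1 - ‖x‖ ^ 2), 2 * x 1 / (1 - ‖x‖ ^ 2),
    2 * x 2 / (1 - ‖x‖ ^ 2)]

theorem norm_sq_E3 (x : E3) : ‖x‖ ^ 2 = x 0 ^ 2 + x 1 ^ 2 + x 2 ^ 2 := by
  simp [EuclideanSpace.norm_sq_eq, Fin.sum_univ_three]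

theorem i_mem_disc {q : Mink} (hq : q ∈ hyperboloid) : i q ∈ disc := by
  obtain ⟨h1, h0⟩ := hq
  have hn := norm_sq_E3 (i q)
  have hT : (1 + q 0) ≠ 0 := by positivity
  have : ‖i q‖ ^ 2 < 1 := by
    rw [hn]
    simp only [i, mink] at *
    simp
    rw [div_pow, div_pow, div_pow, ← add_div, ← add_div, div_lt_one (by positivity)]
    nlinarith
  exact (sq_lt_one_iff₀ (norm_nonneg _)).1 this

theorem iInv_i {q : Mink} (hq : q ∈ hyperboloid) : iInv (i q) = q := by
  obtain ⟨h1, h0⟩ := hq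
  have hT : (1 + q 0) ≠ 0 := by positivity
  have hn : ‖i q‖ ^ 2 = (q 0 - 1) / (1 + q 0) := by
    rw [norm_sq_E3]
    simp only [i, mink] at *
    simp
    field_simp
    linear_combination -h1
  have hn' : 1 - ‖i q‖ ^ 2 = 2 / (1 + q 0) := by
    rw [hn]; field_simp; ring
  have hn'' : 1 + ‖i q‖ ^ 2 = 2 * q 0 / (1 + q 0) := by
    rw [hn]; field_simp; ring
  ext k
  simp only [iInv, hn', hn'']
  fin_cases k <;> simp [i] <;> field_simp

theorem i_iInv {x : E3} (hx : x ∈ disc) : iInv x ∈ hyperboloid ∧ i (iInv x) = x := by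
  have hlt : ‖x‖ ^ 2 < 1 := (sq_lt_one_iff₀ (norm_nonneg _)).2 hx
  have hp : 0 < 1 - ‖x‖ ^ 2 := by linarith
  have hn := norm_sq_E3 x
  refine ⟨⟨?_, ?_⟩, ?_⟩
  · simp [iInv, mink]
    field_simp
    rw [hn]
    ring
  · simp [iInv]
    positivity
  · have : 1 + (1 + ‖x‖ ^ 2) / (1 - ‖x‖ ^ 2) = 2 / (1 - ‖x‖ ^ 2) := by field_simp; ring
    ext k
    fin_cases k <;> simp [i, iInv, this] <;> field_simp

/-- The extension of `i` to the spheres at infinity, as a map on the positive light cone. -/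
def iBdry (p : Mink) : E3 := !₂[p 1 / p 0, p 2 / p 0, p 3 / p 0]

/-- Stereographic projection from the sphere at infinity of the disc to `ℂ ∪ {∞}`. -/
def jBdry (x : E3) : OnePoint ℂ :=
  if x = !₂[0, 0, 1] then OnePoint.infty
  else (((x 0 : ℂ) + Complex.I * (x 1 : ℂ)) / (1 - (x 2 : ℂ)) : ℂ)

/-- The isometry from the disc to the upper half space which extends `jBdry`: the inversion in the
sphere of radius `√2` about `(0, 0, 1)`, followed by the reflection `z ↦ -z`. -/
def j (x : E3) : E3 :=
  !₂[2 * x 0 / (x 0 ^ 2 + x 1 ^ 2 + (1 - x 2) ^ 2),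
    2 * x 1 / (x 0 ^ 2 + x 1 ^ 2 + (1 - x 2) ^ 2),
    (1 - (x 0 ^ 2 + x 1 ^ 2 + x 2 ^ 2)) / (x 0 ^ 2 + x 1 ^ 2 + (1 - x 2) ^ 2)]

/-- The inverse of `j`. -/
def jInv (y : E3) : E3 :=
  !₂[2 * y 0 / (y 0 ^ 2 + y 1 ^ 2 + (1 + y 2) ^ 2),
    2 * y 1 / (y 0 ^ 2 + y 1 ^ 2 + (1 + y 2) ^ 2),
    (y 0 ^ 2 + y 1 ^ 2 + y 2 ^ 2 - 1) / (y 0 ^ 2 + y 1 ^ 2 + (1 + y 2) ^ 2)]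

theorem disc_pos {x : E3} (hx : x ∈ disc) :
    0 < x 0 ^ 2 + x 1 ^ 2 + (1 - x 2) ^ 2 ∧ x 0 ^ 2 + x 1 ^ 2 + x 2 ^ 2 < 1 := by
  have hlt : ‖x‖ ^ 2 < 1 := (sq_lt_one_iff₀ (norm_nonneg _)).2 hx
  rw [norm_sq_E3] at hlt
  refine ⟨?_, hlt⟩
  nlinarith [sq_nonneg (x 0), sq_nonneg (x 1), sq_nonneg (1 - x 2), sq_nonneg (1 + x 2)]

theorem jInv_j {x : E3} (hx : x ∈ disc) : j x ∈ upper ∧ jInv (j x) = x := by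
  obtain ⟨hd, hlt⟩ := disc_pos hx
  set d := x 0 ^ 2 + x 1 ^ 2 + (1 - x 2) ^ 2 with hdd
  have h0 : j x 0 = 2 * x 0 / d := rfl
  have h1 : j x 1 = 2 * x 1 / d := rfl
  have h2 : j x 2 = (1 - (x 0 ^ 2 + x 1 ^ 2 + x 2 ^ 2)) / d := rfl
  refine ⟨?_, ?_⟩
  · change 0 < j x 2
    rw [h2]
    exact div_pos (by linarith) hd
  · have e : (j x 0) ^ 2 + (j x 1) ^ 2 + (1 + j x 2) ^ 2 = 4 / d := by
      rw [h0, h1, h2]; field_simp; rw [hdd]; ring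
    have e' : (j x 0) ^ 2 + (j x 1) ^ 2 + (j x 2) ^ 2 - 1 = 4 * x 2 / d := by
      rw [h0, h1, h2]; field_simp; rw [hdd]; ring
    ext k
    simp only [jInv, e, e']
    fin_cases k
    · simp [h0]; field_simp; ring
    · simp [h1]; field_simp; ring
    · simp; field_simp

theorem j_jInv {y : E3} (hy : y ∈ upper) : jInv y ∈ disc ∧ j (jInv y) = y := by
  have hy : 0 < y 2 := hy
  have hd : 0 < y 0 ^ 2 + y 1 ^ 2 + (1 + y 2) ^ 2 := by positivity
  set d := y 0 ^ 2 + y 1 ^ 2 + (1 + y 2) ^ 2 with hdd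
  have h0 : jInv y 0 = 2 * y 0 / d := rfl
  have h1 : jInv y 1 = 2 * y 1 / d := rfl
  have h2 : jInv y 2 = (y 0 ^ 2 + y 1 ^ 2 + y 2 ^ 2 - 1) / d := rfl
  have e : (jInv y 0) ^ 2 + (jInv y 1) ^ 2 + (1 - jInv y 2) ^ 2 = 4 / d := by
    rw [h0, h1, h2]; field_simp; rw [hdd]; ring
  have e' : 1 - ((jInv y 0) ^ 2 + (jInv y 1) ^ 2 + (jInv y 2) ^ 2) = 4 * y 2 / d := by
    rw [h0, h1, h2]; field_simp; rw [hdd]; ring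
  refine ⟨?_, ?_⟩
  · have : ‖jInv y‖ ^ 2 < 1 := by
      rw [norm_sq_E3]
      have : 0 < 4 * y 2 / d := by positivity
      linarith
    exact (sq_lt_one_iff₀ (norm_nonneg _)).1 this
  · ext k
    simp only [j, e, e']
    fin_cases k
    · simp [h0]; field_simp; ring
    · simp [h1]; field_simp; ring
    · simp; field_simp

theorem differentiableAt_j {x : E3} (hx : x 0 ^ 2 + x 1 ^ 2 + (1 - x 2) ^ 2 ≠ 0) :
    DifferentiableAt ℝ j x := by
  rw [differentiableAt_euclidean]
  intro k
  have hd : DifferentiableAt ℝ (fun y : E3 => y 0 ^ 2 + y 1 ^ 2 + (1 - y 2) ^ 2) x := by fun_prop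
  have h0 : DifferentiableAt ℝ (fun y : E3 => 2 * y 0) x := by fun_prop
  have h1 : DifferentiableAt ℝ (fun y : E3 => 2 * y 1) x := by fun_prop
  have h2 : DifferentiableAt ℝ (fun y : E3 => 1 - (y 0 ^ 2 + y 1 ^ 2 + y 2 ^ 2)) x := by fun_prop
  fin_cases k
  · have := h0.fun_mul (hd.fun_inv hx)
    exact this
  · have := h1.fun_mul (hd.fun_inv hx)
    exact this
  · have := h2.fun_mul (hd.fun_inv hx)
    exact this

/-- The map `j` preserves the hyperbolic metrics. -/
theorem j_isometry {x : E3} (hx : x ∈ disc) (v : E3) :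
    ‖fderiv ℝ j x v‖ ^ 2 / (j x 2) ^ 2 = 4 * ‖v‖ ^ 2 / (1 - ‖x‖ ^ 2) ^ 2 := by
  obtain ⟨hd, hlt⟩ := disc_pos hx
  have hl : HasDerivAt (fun t : ℝ => x + t • v) v 0 := by
    simpa using ((hasDerivAt_id (0 : ℝ)).smul_const v).const_add x
  have hj : HasDerivAt (fun t : ℝ => j (x + t • v)) (fderiv ℝ j x v) 0 := by
    have h1 : HasFDerivAt j (fderiv ℝ j x) (x + (0 : ℝ) • v) := by
      simpa using (differentiableAt_j hd.ne').hasFDerivAt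
    exact h1.comp_hasDerivAt 0 hl
  have hjk : ∀ k, HasDerivAt (fun t : ℝ => j (x + t • v) k) (fderiv ℝ j x v k) 0 := fun k =>
    ((EuclideanSpace.proj k : E3 →L[ℝ] ℝ).hasFDerivAt).comp_hasDerivAt 0 hj
  have c : ∀ k, HasDerivAt (fun t : ℝ => x k + t * v k) (v k) 0 := fun k => by
    simpa using ((hasDerivAt_id (0 : ℝ)).mul_const (v k)).const_add (x k)
  have cd := (((c 0).pow 2).add ((c 1).pow 2)).add (((c 2).const_sub 1).pow 2)
  have cr := ((((c 0).pow 2).add ((c 1).pow 2)).add ((c 2).pow 2)).const_sub 1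
  have hne : (x 0 + 0 * v 0) ^ 2 + (x 1 + 0 * v 1) ^ 2 + (1 - (x 2 + 0 * v 2)) ^ 2 ≠ 0 := by
    simpa using hd.ne'
  have u0 := (hjk 0).unique (((c 0).const_mul 2).div cd hne)
  have u1 := (hjk 1).unique (((c 1).const_mul 2).div cd hne)
  have u2 := (hjk 2).unique (cr.div cd hne)
  simp at u0 u1 u2
  have h2 : j x 2 = (1 - (x 0 ^ 2 + x 1 ^ 2 + x 2 ^ 2)) /
    (x 0 ^ 2 + x 1 ^ 2 + (1 - x 2) ^ 2) := rfl
  have hlt' : 1 - (x 0 ^ 2 + x 1 ^ 2 + x 2 ^ 2) ≠ 0 := by linarith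
  rw [norm_sq_E3, norm_sq_E3, norm_sq_E3, u0, u1, u2, h2]
  have hd' := hd.ne'
  field_simp
  ring

/-- The map `j` extends continuously to stereographic projection on the sphere at infinity. -/
theorem j_tendsto_bdry {b : E3} (hb : ‖b‖ = 1) (z : ℂ) (hz : jBdry b = z) :
    Filter.Tendsto j (𝓝 b) (𝓝 !₂[z.re, z.im, 0]) := by
  have hn : b 0 ^ 2 + b 1 ^ 2 + b 2 ^ 2 = 1 := by
    rw [← norm_sq_E3, hb, one_pow]
  have hb' : b ≠ !₂[0, 0, 1] := by
    rintro rfl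
    simp [jBdry] at hz
  rw [jBdry, if_neg hb', OnePoint.coe_eq_coe] at hz
  have h2 : 1 - b 2 ≠ 0 := by
    intro h
    have h2 : b 2 = 1 := by linarith
    rw [h2] at hn
    have h0 : b 0 = 0 := by nlinarith [sq_nonneg (b 0), sq_nonneg (b 1)]
    have h1 : b 1 = 0 := by nlinarith [sq_nonneg (b 0), sq_nonneg (b 1)]
    apply hb'
    ext k
    fin_cases k <;> simp [h0, h1, h2]
  have hd : b 0 ^ 2 + b 1 ^ 2 + (1 - b 2) ^ 2 = 2 * (1 - b 2) := by linear_combination hn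
  have hd' : b 0 ^ 2 + b 1 ^ 2 + (1 - b 2) ^ 2 ≠ 0 := by
    rw [hd]
    exact mul_ne_zero two_ne_zero h2
  have hz' : z = ⟨b 0 / (1 - b 2), b 1 / (1 - b 2)⟩ := by
    have h2' : (1 : ℂ) - (b 2 : ℂ) ≠ 0 := fun h => h2 (by simpa using congrArg Complex.re h)
    rw [← hz, div_eq_iff h2']
    apply Complex.ext <;> simp <;> field_simp
  have : j b = !₂[z.re, z.im, 0] := by
    ext k
    fin_cases k <;> simp [j, hd, hz', hn] <;> field_simp
  rw [← this]
  exact (differentiableAt_j hd').continuousAt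

/-- The map `j` sends the north pole of the sphere at infinity to `∞`. -/
theorem j_tendsto_infty :
    Filter.Tendsto (fun x => ‖j x‖) (𝓝[disc] !₂[0, 0, 1]) Filter.atTop := by
  rw [Filter.tendsto_atTop]
  intro B
  have hc : Continuous fun x : E3 => x 0 ^ 2 + x 1 ^ 2 + (1 - x 2) ^ 2 := by fun_prop
  have ht : Filter.Tendsto (fun x : E3 => x 0 ^ 2 + x 1 ^ 2 + (1 - x 2) ^ 2)
      (𝓝[disc] !₂[0, 0, 1]) (𝓝 0) := by
    have := (hc.tendsto !₂[0, 0, 1]).mono_left (nhdsWithin_le_nhds (s := disc))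
    simpa using this
  have hB : 0 < 4 / (|B| + 1) ^ 2 := by positivity
  filter_upwards [ht.eventually_lt_const hB, self_mem_nhdsWithin] with x hxB hx
  obtain ⟨hd, -⟩ := disc_pos hx
  set d := x 0 ^ 2 + x 1 ^ 2 + (1 - x 2) ^ 2 with hdd
  have h0 : j x 0 = 2 * x 0 / d := rfl
  have h1 : j x 1 = 2 * x 1 / d := rfl
  have h2 : j x 2 = (1 - (x 0 ^ 2 + x 1 ^ 2 + x 2 ^ 2)) / d := rfl
  have e : ‖j x‖ ^ 2 + 2 * j x 2 + 1 = 4 / d := by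
    rw [norm_sq_E3, h0, h1, h2]; field_simp; rw [hdd]; ring
  have h3 : j x 2 ≤ ‖j x‖ := by
    refine le_of_sq_le_sq ?_ (norm_nonneg _)
    rw [norm_sq_E3]
    nlinarith [sq_nonneg (j x 0), sq_nonneg (j x 1)]
  have h4 : (|B| + 1) ^ 2 < 4 / d := by
    rw [lt_div_iff₀ (by positivity)] at hxB
    rw [lt_div_iff₀ hd]
    linarith
  have h5 : (|B| + 1) ^ 2 < (‖j x‖ + 1) ^ 2 := by linarith
  have h6 := lt_of_pow_lt_pow_left₀ 2 (by positivity) h5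
  linarith [le_abs_self B]

/-! ### The action of `SL(2, ℂ)` on the upper half space -/

/-- The action on the disc model, transported from the hyperboloid model. -/
def discAct (A : SpecialLinearGroup (Fin 2) ℂ) (x : E3) : E3 := i (minkAct A (iInv x))

/-- The action on the upper half space model, transported from the disc model. -/
def upperAct (A : SpecialLinearGroup (Fin 2) ℂ) (x : E3) : E3 := j (discAct A (jInv x))

/-- Parabolic elements. -/
def IsParabolic (A : SpecialLinearGroup (Fin 2) ℂ) : Prop := A.1.trace = 2 ∨ A.1.trace = -2

/-! ### Decorated horospheres in the upper half space -/

/-- Horospheres in the upper half space. -/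
def IsHorosphere (s : Set E3) : Prop := ∃ s₀, IsHorosphereHyp s₀ ∧ s = j '' (i '' s₀)

/-- `c ∈ ℂ ∪ {∞}` is the centre of the horosphere `s` in the upper half space. -/
def IsCentre (s : Set E3) (c : OnePoint ℂ) : Prop :=
  ∃ s₀ p, IsCentreHyp s₀ p ∧ s = j '' (i '' s₀) ∧ c = jBdry (iBdry p)

/-- A line field on a horosphere is parallel if it is invariant under the parabolic isometries that
preserve the horosphere. -/
def IsParallel (X : DirectedSet E3) : Prop :=
  ∀ A : SpecialLinearGroup (Fin 2) ℂ, IsParabolic A → upperAct A '' X.carrier = X.carrier →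
    X.push (upperAct A) = X

/-- Decorated horospheres: horospheres with a parallel oriented line field. (A parallel line field
is automatically smooth, as the parabolic isometries act simply transitively.) -/
def IsDecoratedHorosphere (X : DirectedSet E3) : Prop :=
  IsHorosphere X.carrier ∧ X.IsOrientedLineField ∧ IsParallel X

/-- The horizontal tangent vector given by a complex number. -/
def horizontal (α : ℂ) : E3 := !₂[α.re, α.im, 0]

/-- `n` is the highest point of `s`. -/
def IsNorthPole (s : Set E3) (n : E3) : Prop := n ∈ s ∧ ∀ q ∈ s, q ≠ n → q 2 < n 2

/-- `α` is a specification of the decoration of a horosphere centred at `∞`: it directs the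
oriented line at every point. -/
def IsSpecification (X : DirectedSet E3) (α : ℂ) : Prop :=
  ∀ q ∈ X.carrier, horizontal α ∈ X.dir q

/-- `α` is a north-pole specification of the decoration of a horosphere not centred at `∞`. -/
def IsNorthPoleSpecification (X : DirectedSet E3) (α : ℂ) : Prop :=
  ∃ n, IsNorthPole X.carrier n ∧ horizontal α ∈ X.dir n

/-! ### The maps from spinors to horospheres and decorated horospheres -/

/-- The horosphere of a nonzero spinor, `k = j ∘ i ∘ h ∘ g ∘ f`. -/
def k (κ : Fin 2 → ℂ) : Set E3 := j '' (i '' h (g (f κ)))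

/-- The decorated horosphere of a nonzero spinor, `K = J ∘ I ∘ H ∘ G ∘ F`, where `I` and `J` are
given by the isometries `i`, `j` and their derivatives. -/
def K (κ : Fin 2 → ℂ) (hκ : κ ≠ 0) : DirectedSet E3 :=
  ((H (G (F κ hκ))).push i).push j

end SpinorHorosphere

end

noncomputable section

namespace SpinorHorosphere

/-! ### The Minkowski form -/

/-! Write `p = g (f κ)` and `v = flagVec κ`, the two vectors that span the flag of `κ`, with `v`
spacelike and orthogonal to the null vector `p`.

The tangent space of the horosphere `h p` at `q` is the set of vectors orthogonal to both `q` and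
`p` (`mem_tangentVectors_h_iff`). Since `⟨p, q⟩ = 1`, the combination `a p + b v` is tangent exactly
when `a = -b ⟨v, q⟩`. Hence the oriented line at `q` is the ray of `horoVec κ q = v - ⟨v, q⟩ p`
(`dir_H_G_F`), a nonzero spacelike vector.

On the hyperboloid, `j ∘ i` is `(X, Y, 1) / (T - Z)`, with an explicit inverse. So the carrier, the
rays and the action of `SL(2, ℂ)` all transfer between the upper half space and Minkowski space,
where the action is linear and preserves the form.

For parallelism, let a parabolic `A` preserve the horosphere. Then `p` and `A p` are orthogonal null
vectors. Because `⟨g (f κ), g (f ν)⟩ = 2 |det (κ, ν)|²`, this makes `κ` an eigenvector of `A`, and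
trace `±2` makes its eigenvalue `±1` (`mulVec_eq_of_image_eq`). Thus `A` fixes `p`, and `det A = 1`
forces `A v = v + r p` with `r` real (`minkAct_flagVec`). The multiple of `p` drops out of the
projected vector, so the field `horoVec κ` is equivariant (`isParallel_K`).

For the explicit description, `⟨x, p⟩ = 1` becomes `|ξ - η w|² + |η|² z² = z` at the point of height
`z` over `w ∈ ℂ` (`mem_carrier_K_iff`). The sphere, the plane and the north pole are read off from
this equation, and the decorations from the derivative of `toUpper` on `horoVec`. -/

theorem mink_comm (p q : Mink) : mink p q = mink q p := by
  simp only [mink]; ring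

theorem mink_add_left (p p' q : Mink) : mink (p + p') q = mink p q + mink p' q := by
  simp only [mink, Pi.add_apply]; ring

theorem mink_smul_left (c : ℝ) (p q : Mink) : mink (c • p) q = c * mink p q := by
  simp only [mink, Pi.smul_apply, smul_eq_mul]; ring

theorem mink_sub_left (p p' q : Mink) : mink (p - p') q = mink p q - mink p' q := by
  simp only [mink, Pi.sub_apply]; ring

theorem hasDerivAt_mink {γ δ : ℝ → Mink} {u w : Mink} {t : ℝ} (hγ : HasDerivAt γ u t)
    (hδ : HasDerivAt δ w t) :
    HasDerivAt (fun s => mink (γ s) (δ s)) (mink u (δ t) + mink (γ t) w) t := by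
  rw [hasDerivAt_pi] at hγ hδ
  have := ((((hγ 0).mul (hδ 0)).sub ((hγ 1).mul (hδ 1))).sub ((hγ 2).mul (hδ 2))).sub
    ((hγ 3).mul (hδ 3))
  refine this.congr_deriv ?_
  simp only [mink]; ring

/-- The reversed Cauchy–Schwarz inequality on the positive light cone. -/
theorem mink_nonneg_of_mem_lightCone {p q : Mink} (hp : p ∈ lightCone) (hq : q ∈ lightCone) :
    0 ≤ mink p q := by
  obtain ⟨hp, hp0⟩ := hp
  obtain ⟨hq, hq0⟩ := hq
  simp only [mink] at *
  have : 0 ≤ p 0 * q 0 * (p 0 * q 0 - p 1 * q 1 - p 2 * q 2 - p 3 * q 3) := by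
    -- For null vectors with spatial parts `x`, `y`, the right-hand side is the squared length of `q
    -- 0 x - p 0 y`.
    have e : 2 * (p 0 * q 0 * (p 0 * q 0 - p 1 * q 1 - p 2 * q 2 - p 3 * q 3)) =
      (q 0 * p 1 - p 0 * q 1) ^ 2 + (q 0 * p 2 - p 0 * q 2) ^ 2 + (q 0 * p 3 - p 0 * q 3) ^ 2 := by
      linear_combination q 0 ^ 2 * hp + p 0 ^ 2 * hq
    have : 0 ≤ (q 0 * p 1 - p 0 * q 1) ^ 2 + (q 0 * p 2 - p 0 * q 2) ^ 2 +
      (q 0 * p 3 - p 0 * q 3) ^ 2 := by positivity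
    linarith
  exact nonneg_of_mul_nonneg_right this (by positivity)

/-- The equality case of the reversed Cauchy–Schwarz inequality: the sum of squares behind it
vanishes, so all coordinates are proportional. -/
theorem sameRay_of_mink_eq_zero {p q : Mink} (hp : p ∈ lightCone) (hq : q ∈ lightCone)
    (hpq : mink p q = 0) : SameRay ℝ p q := by
  obtain ⟨hp, hp0⟩ := hp
  obtain ⟨hq, hq0⟩ := hq
  simp only [mink] at hp hq hpq
  have e : (q 0 * p 1 - p 0 * q 1) ^ 2 + (q 0 * p 2 - p 0 * q 2) ^ 2 +
      (q 0 * p 3 - p 0 * q 3) ^ 2 = 0 := by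
    linear_combination 2 * p 0 * q 0 * hpq - q 0 ^ 2 * hp - p 0 ^ 2 * hq
  have e1 : q 0 * p 1 - p 0 * q 1 = 0 := by
    rw [← sq_eq_zero_iff]
    apply le_antisymm _ (sq_nonneg _)
    linarith [sq_nonneg (q 0 * p 2 - p 0 * q 2), sq_nonneg (q 0 * p 3 - p 0 * q 3)]
  have e2 : q 0 * p 2 - p 0 * q 2 = 0 := by
    rw [← sq_eq_zero_iff]
    apply le_antisymm _ (sq_nonneg _)
    linarith [sq_nonneg (q 0 * p 1 - p 0 * q 1), sq_nonneg (q 0 * p 3 - p 0 * q 3)]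
  have e3 : q 0 * p 3 - p 0 * q 3 = 0 := by
    rw [← sq_eq_zero_iff]
    apply le_antisymm _ (sq_nonneg _)
    linarith [sq_nonneg (q 0 * p 2 - p 0 * q 2), sq_nonneg (q 0 * p 1 - p 0 * q 1)]
  refine Or.inr (Or.inr ⟨q 0, p 0, hq0, hp0, ?_⟩)
  ext m
  fin_cases m <;> simp <;> linarith

/-! ### Horospheres in the hyperboloid -/

theorem h_nonempty {p : Mink} (hp : p ∈ lightCone) : (h p).Nonempty := by
  obtain ⟨hp, hp0⟩ := hp
  simp only [mink] at hp
  set s : ℝ := 1 / (2 * p 0 ^ 2) with hs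
  have hs' : 2 * p 0 ^ 2 * s = 1 := by rw [hs]; field_simp
  -- The point is `p / 2 + s p̃`, where `p̃` is `p` with its spatial part negated. Since `⟨p, p̃⟩ =
  -- 2 (p 0)²`, the value of `s` makes both `⟨q, q⟩` and `⟨q, p⟩` equal to `1`.
  refine ⟨![(1 / 2 + s) * p 0, (1 / 2 - s) * p 1, (1 / 2 - s) * p 2, (1 / 2 - s) * p 3],
    ⟨?_, ?_⟩, ?_⟩
  · simp [mink]
    linear_combination hs' + (1 / 2 - s) ^ 2 * hp
  · simp
    positivity
  · simp [mink]
    linear_combination hs' + (1 / 2 - s) * hp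

theorem isLightlikePlane_of_mem_lightCone {p : Mink} (hp : p ∈ lightCone) (c : ℝ) :
    IsLightlikePlane {x | mink x p = c} :=
  ⟨p, fun h0 => by simpa [h0] using hp.2, hp.1, c, rfl⟩

theorem isHorosphereHyp_h {p : Mink} (hp : p ∈ lightCone) : IsHorosphereHyp (h p) :=
  ⟨h_nonempty hp, _, isLightlikePlane_of_mem_lightCone hp 1, rfl⟩

theorem isCentreHyp_h {p : Mink} (hp : p ∈ lightCone) : IsCentreHyp (h p) p := by
  refine ⟨h_nonempty hp, hp, _, isLightlikePlane_of_mem_lightCone hp 1, rfl, fun p' hp' => ?_⟩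
  constructor
  · intro H
    apply sameRay_of_mink_eq_zero hp' hp
    by_contra hne
    have hpos : 0 < mink p' p := lt_of_le_of_ne (mink_nonneg_of_mem_lightCone hp' hp) (Ne.symm hne)
    -- If the product is positive, the ray of `p'` meets the plane at this parameter.
    refine H (mink p' p)⁻¹ (inv_pos.2 hpos) ?_
    change mink _ _ = 1
    rw [mink_smul_left, inv_mul_cancel₀ hne]
  · intro H t ht hmem
    change mink _ _ = 1 at hmem
    obtain ⟨r, -, hr⟩ := H.exists_nonneg_right (fun h0 => by simpa [h0] using hp.2)
    rw [hr, mink_smul_left, mink_smul_left, hp.1] at hmem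
    simp at hmem

theorem mink_eq_zero_of_mem_tangentVectors_h {p q w : Mink} (hw : w ∈ tangentVectors (h p) q) :
    mink w q = 0 ∧ mink w p = 0 := by
  obtain ⟨γ, h0, hm, hd⟩ := hw
  constructor
  · have h1 := hasDerivAt_mink hd hd
    have h2 : HasDerivAt (fun s => mink (γ s) (γ s)) 0 0 :=
      (hasDerivAt_const (0 : ℝ) (1 : ℝ)).congr_of_eventuallyEq (hm.mono fun t ht => ht.1.1)
    have := h1.unique h2
    rw [h0, mink_comm q w] at this
    linarith
  · have h1 := hasDerivAt_mink hd (hasDerivAt_const (0 : ℝ) p)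
    have h2 : HasDerivAt (fun s => mink (γ s) p) 0 0 :=
      (hasDerivAt_const (0 : ℝ) (1 : ℝ)).congr_of_eventuallyEq (hm.mono fun t ht => ht.2)
    have := h1.unique h2
    simpa [mink] using this

/-- A parabola through `q` in the horosphere of `p`. -/
theorem eventually_parabola_mem_h {p q u : Mink} (hp : p ∈ lightCone) (hq : q ∈ h p)
    (huq : mink u q = 0) (hup : mink u p = 0) :
    ∀ᶠ t in 𝓝 (0 : ℝ), q + t • u - (t ^ 2 * (mink u u / 2)) • p ∈ h p := by
  have hc : Continuous fun t : ℝ => (q + t • u - (t ^ 2 * (mink u u / 2)) • p) 0 := by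
    simp only [Pi.add_apply, Pi.sub_apply, Pi.smul_apply, smul_eq_mul]
    fun_prop
  have h0 : 0 < (q + (0 : ℝ) • u - ((0 : ℝ) ^ 2 * (mink u u / 2)) • p) 0 := by
    simpa using hq.1.2
  filter_upwards [hc.continuousAt.eventually_const_lt h0] with t ht
  have e1 := hq.1.1
  have e2 := hq.2
  have e3 := hp.1
  -- The quadratic term along `p` compensates `t² ⟨u, u⟩` because `⟨q, p⟩ = 1`. It leaves the
  -- product with `p` unchanged because `p` is null.
  set m := mink u u with hm
  simp only [mink] at hm e1 e2 e3 huq hup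
  refine ⟨⟨?_, ht⟩, ?_⟩
  · simp only [mink, Pi.add_apply, Pi.sub_apply, Pi.smul_apply, smul_eq_mul]
    linear_combination e1 - t ^ 2 * hm + 2 * t * huq - t ^ 2 * m * e2 - t ^ 3 * m * hup
      + (t ^ 2 * (m / 2)) ^ 2 * e3
  · simp only [mink, Pi.add_apply, Pi.sub_apply, Pi.smul_apply, smul_eq_mul]
    linear_combination e2 + t * hup - t ^ 2 * (m / 2) * e3

theorem hasDerivAt_parabola (p q u : Mink) (c : ℝ) :
    HasDerivAt (fun t : ℝ => q + t • u - (t ^ 2 * c) • p) u 0 := by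
  have h1 : HasDerivAt (fun t : ℝ => q + t • u) u 0 := by
    simpa using ((hasDerivAt_id (0 : ℝ)).smul_const u).const_add q
  have h2 : HasDerivAt (fun t : ℝ => (t ^ 2 * c) • p) 0 0 := by
    simpa using (((hasDerivAt_pow 2 (0 : ℝ)).mul_const c).smul_const p)
  simpa using h1.fun_sub h2

theorem mem_tangentVectors_h_iff {p q u : Mink} (hp : p ∈ lightCone) (hq : q ∈ h p) :
    u ∈ tangentVectors (h p) q ↔ mink u q = 0 ∧ mink u p = 0 :=
  ⟨mink_eq_zero_of_mem_tangentVectors_h, fun ⟨h1, h2⟩ =>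
    ⟨_, by simp, eventually_parabola_mem_h hp hq h1 h2, hasDerivAt_parabola p q u _⟩⟩

/-- Two horospheres that coincide have orthogonal, hence proportional, lightlike normals. -/
theorem mink_eq_zero_of_h_subset {p p' q u : Mink} (hp : p ∈ lightCone) (hq : q ∈ h p)
    (huq : mink u q = 0) (hup : mink u p = 0) (huu : mink u u ≠ 0) (hsub : h p ⊆ h p') :
    mink p p' = 0 := by
  have hev := eventually_parabola_mem_h hp hq huq hup
  have hneg : Filter.Tendsto (fun t : ℝ => -t) (𝓝 0) (𝓝 0) := by
    simpa using (continuous_neg (G := ℝ)).tendsto 0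
  -- Both `t` and `-t` are taken on the parabola, with `t ≠ 0`. The second difference of `⟨·, p'⟩`,
  -- which is constant on the horosphere, then kills the linear term and leaves `t² ⟨u, u⟩ ⟨p, p'⟩ =
  -- 0`.
  obtain ⟨t, ⟨h1, h2⟩, ht⟩ :=
    (((hev.and (hneg.eventually hev)).filter_mono (nhdsWithin_le_nhds (s := {0}ᶜ))).and
      self_mem_nhdsWithin).exists
  have ht : t ≠ 0 := ht
  have e0 := (hsub hq).2
  have e1 := (hsub h1).2
  have e2 := (hsub h2).2
  rw [mink_sub_left, mink_add_left, mink_smul_left, mink_smul_left] at e1 e2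
  have : t ^ 2 * mink u u * mink p p' = 0 := by linear_combination 2 * e0 - e1 - e2
  exact (mul_eq_zero.1 this).resolve_left (mul_ne_zero (pow_ne_zero 2 ht) huu)

/-! ### The hyperboloid and the upper half space -/

/-- The composite `j ∘ i` on the hyperboloid. -/
def toUpper (q : Mink) : E3 := !₂[q 1 / (q 0 - q 3), q 2 / (q 0 - q 3), 1 / (q 0 - q 3)]

/-- The inverse of `toUpper`. -/
def ofUpper (y : E3) : Mink :=
  ![(1 + (y 0 ^ 2 + y 1 ^ 2 + y 2 ^ 2)) / (2 * y 2), y 0 / y 2, y 1 / y 2,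
    (y 0 ^ 2 + y 1 ^ 2 + y 2 ^ 2 - 1) / (2 * y 2)]

/-- The derivative of `toUpper` at `q` in the direction `u`. -/
def toUpperDeriv (q u : Mink) : E3 :=
  !₂[(u 1 * (q 0 - q 3) - q 1 * (u 0 - u 3)) / (q 0 - q 3) ^ 2,
    (u 2 * (q 0 - q 3) - q 2 * (u 0 - u 3)) / (q 0 - q 3) ^ 2,
    -(u 0 - u 3) / (q 0 - q 3) ^ 2]

/-- From `(T - Z)(T + Z) = 1 + X² + Y² > 0` and `T > 0`. This keeps the denominator of `toUpper`
away from zero. -/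
theorem sub_pos_of_mem_hyperboloid {q : Mink} (hq : q ∈ hyperboloid) : 0 < q 0 - q 3 := by
  obtain ⟨h1, h0⟩ := hq
  simp only [mink] at h1
  by_contra! hc
  nlinarith [sq_nonneg (q 1), sq_nonneg (q 2), mul_nonneg (sub_nonneg.2 (sub_nonpos.1 hc)) h0.le]

theorem j_i {q : Mink} (hq : q ∈ hyperboloid) : j (i q) = toUpper q := by
  have hs := sub_pos_of_mem_hyperboloid hq
  obtain ⟨h1, h0⟩ := hq
  simp only [mink] at h1
  have hT : 1 + q 0 ≠ 0 := by positivity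
  have e0 : i q 0 = q 1 / (1 + q 0) := rfl
  have e1 : i q 1 = q 2 / (1 + q 0) := rfl
  have e2 : i q 2 = q 3 / (1 + q 0) := rfl
  have ed : i q 0 ^ 2 + i q 1 ^ 2 + (1 - i q 2) ^ 2 = 2 * (q 0 - q 3) / (1 + q 0) := by
    rw [e0, e1, e2]; field_simp; linear_combination -h1
  have en : 1 - (i q 0 ^ 2 + i q 1 ^ 2 + i q 2 ^ 2) = 2 / (1 + q 0) := by
    rw [e0, e1, e2]; field_simp; linear_combination h1
  have hs' := hs.ne'
  ext m
  simp only [j, ed, en, toUpper]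
  fin_cases m <;> simp [e0, e1] <;> field_simp

theorem toUpper_mem_upper {q : Mink} (hq : q ∈ hyperboloid) : toUpper q ∈ upper :=
  one_div_pos.2 (sub_pos_of_mem_hyperboloid hq)

theorem ofUpper_toUpper {q : Mink} (hq : q ∈ hyperboloid) : ofUpper (toUpper q) = q := by
  have hs := (sub_pos_of_mem_hyperboloid hq).ne'
  obtain ⟨h1, h0⟩ := hq
  simp only [mink] at h1
  ext m
  fin_cases m <;> simp [ofUpper, toUpper] <;> field_simp
  · linear_combination -h1
  · linear_combination -h1

theorem ofUpper_mem_hyperboloid {y : E3} (hy : y ∈ upper) : ofUpper y ∈ hyperboloid := by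
  have hy : 0 < y 2 := hy
  constructor
  · simp [mink, ofUpper]
    field_simp
    ring
  · simp [ofUpper]
    positivity

theorem toUpper_ofUpper {y : E3} (hy : y ∈ upper) : toUpper (ofUpper y) = y := by
  have hy : 0 < y 2 := hy
  have e : (1 + (y 0 ^ 2 + y 1 ^ 2 + y 2 ^ 2)) / (2 * y 2) -
      (y 0 ^ 2 + y 1 ^ 2 + y 2 ^ 2 - 1) / (2 * y 2) = 1 / y 2 := by
    field_simp; ring
  ext m
  fin_cases m <;> simp [toUpper, ofUpper, e] <;> field_simp

theorem iInv_jInv {y : E3} (hy : y ∈ upper) : iInv (jInv y) = ofUpper y := by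
  have hq := ofUpper_mem_hyperboloid hy
  have e : y = j (i (ofUpper y)) := by rw [j_i hq, toUpper_ofUpper hy]
  conv_lhs => rw [e, (jInv_j (i_mem_disc hq)).2, iInv_i hq]

theorem injOn_toUpper : Set.InjOn toUpper hyperboloid := fun q hq q' hq' e => by
  rw [← ofUpper_toUpper hq, e, ofUpper_toUpper hq']

theorem hasDerivAt_toUpper {γ : ℝ → Mink} {u : Mink} {t : ℝ} (hγ : HasDerivAt γ u t)
    (hq : γ t ∈ hyperboloid) :
    HasDerivAt (fun s => toUpper (γ s)) (toUpperDeriv (γ t) u) t := by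
  have hs := (sub_pos_of_mem_hyperboloid hq).ne'
  rw [hasDerivAt_pi] at hγ
  have hd := (hγ 0).sub (hγ 3)
  have hp : HasDerivAt (fun s => WithLp.ofLp (toUpper (γ s)))
      (WithLp.ofLp (toUpperDeriv (γ t) u)) t := by
    rw [hasDerivAt_pi]
    intro m
    fin_cases m
    · exact (hγ 1).div hd hs
    · exact (hγ 2).div hd hs
    · exact ((hasDerivAt_const t (1 : ℝ)).div hd hs).congr_deriv (by simp [toUpperDeriv])
  exact ((PiLp.continuousLinearEquiv 2 ℝ fun _ : Fin 3 => ℝ).symm :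
    (Fin 3 → ℝ) →L[ℝ] E3).hasFDerivAt.comp_hasDerivAt t hp

theorem differentiableAt_i {q : Mink} (hq : q ∈ hyperboloid) : DifferentiableAt ℝ i q := by
  have hT : 1 + q 0 ≠ 0 := by have := hq.2; positivity
  rw [differentiableAt_euclidean]
  have hd : DifferentiableAt ℝ (fun x : Mink => 1 + x 0) q := by fun_prop
  intro m
  fin_cases m
  · exact (differentiableAt_apply (1 : Fin 4) q).fun_mul (hd.fun_inv hT)
  · exact (differentiableAt_apply (2 : Fin 4) q).fun_mul (hd.fun_inv hT)
  · exact (differentiableAt_apply (3 : Fin 4) q).fun_mul (hd.fun_inv hT)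

theorem differentiableAt_toUpper {q : Mink} (hq : q ∈ hyperboloid) :
    DifferentiableAt ℝ toUpper q := by
  have hs := (sub_pos_of_mem_hyperboloid hq).ne'
  rw [differentiableAt_euclidean]
  have hd : DifferentiableAt ℝ (fun x : Mink => x 0 - x 3) q := by fun_prop
  intro m
  fin_cases m
  · exact (differentiableAt_apply (1 : Fin 4) q).fun_mul (hd.fun_inv hs)
  · exact (differentiableAt_apply (2 : Fin 4) q).fun_mul (hd.fun_inv hs)
  · exact (differentiableAt_const (1 : ℝ)).fun_mul (hd.fun_inv hs) |>.congr_of_eventuallyEq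
      (Filter.Eventually.of_forall fun x => by simp [toUpper])

theorem differentiableAt_ofUpper {y : E3} (hy : y ∈ upper) : DifferentiableAt ℝ ofUpper y := by
  have hy : 0 < y 2 := hy
  have h2 : DifferentiableAt ℝ (fun x : E3 => 2 * x 2) y := by fun_prop
  have h1 : DifferentiableAt ℝ (fun x : E3 => x 2) y := by fun_prop
  rw [differentiableAt_pi]
  intro m
  fin_cases m
  · exact DifferentiableAt.fun_mul
      (by fun_prop : DifferentiableAt ℝ (fun x : E3 => 1 + (x 0 ^ 2 + x 1 ^ 2 + x 2 ^ 2)) y)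
      (h2.fun_inv (by positivity))
  · exact DifferentiableAt.fun_mul (by fun_prop : DifferentiableAt ℝ (fun x : E3 => x 0) y)
      (h1.fun_inv hy.ne')
  · exact DifferentiableAt.fun_mul (by fun_prop : DifferentiableAt ℝ (fun x : E3 => x 1) y)
      (h1.fun_inv hy.ne')
  · exact DifferentiableAt.fun_mul
      (by fun_prop : DifferentiableAt ℝ (fun x : E3 => x 0 ^ 2 + x 1 ^ 2 + x 2 ^ 2 - 1) y)
      (h2.fun_inv (by positivity))

/-- On vectors tangent to a subset of the hyperboloid, the derivative of `j ∘ i` is that of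
`toUpper`. -/
theorem fderiv_j_fderiv_i {M : Set Mink} {q u : Mink} (hM : M ⊆ hyperboloid) (hq : q ∈ hyperboloid)
    (hu : u ∈ tangentVectors M q) :
    fderiv ℝ j (i q) (fderiv ℝ i q u) = toUpperDeriv q u := by
  obtain ⟨γ, rfl, hm, hd⟩ := hu
  have h1 := (differentiableAt_i hq).hasFDerivAt.comp_hasDerivAt 0 hd
  have h2 := ((differentiableAt_j (disc_pos (i_mem_disc hq)).1.ne').hasFDerivAt
    (x := (i ∘ γ) 0)).comp_hasDerivAt 0 h1
  -- Only the values along the curve matter: `j ∘ i` and `toUpper` agree on the hyperboloid, not on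
  -- all of Minkowski space.
  refine h2.unique ((hasDerivAt_toUpper hd hq).congr_of_eventuallyEq ?_)
  exact hm.mono fun t ht => j_i (hM ht)

/-- Along a curve in the hyperboloid `ofUpper` undoes `toUpper`, so a zero image velocity would give
a zero velocity. Tangency is essential, as the ambient derivative from four to three dimensions has
a kernel. -/
theorem toUpperDeriv_ne_zero {M : Set Mink} {q u : Mink} (hM : M ⊆ hyperboloid)
    (hq : q ∈ hyperboloid) (hu : u ∈ tangentVectors M q) (hu0 : u ≠ 0) : toUpperDeriv q u ≠ 0 := by
  obtain ⟨γ, rfl, hm, hd⟩ := hu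
  intro h0
  have h1 := hasDerivAt_toUpper hd hq
  rw [h0] at h1
  have h2 := ((differentiableAt_ofUpper (toUpper_mem_upper hq)).hasFDerivAt).comp_hasDerivAt 0 h1
  rw [map_zero] at h2
  refine hu0 (hd.unique (h2.congr_of_eventuallyEq ?_))
  exact hm.mono fun t ht => (ofUpper_toUpper (hM ht)).symm

/-! ### The action of `SL(2, ℂ)` -/

theorem hermAct_add (A : SpecialLinearGroup (Fin 2) ℂ) (S S' : Herm) :
    hermAct A (S + S') = hermAct A S + hermAct A S' := by
  apply Subtype.ext
  simp [hermAct, Matrix.mul_add, Matrix.add_mul]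

theorem hermAct_smul (A : SpecialLinearGroup (Fin 2) ℂ) (c : ℝ) (S : Herm) :
    hermAct A (c • S) = c • hermAct A S := by
  apply Subtype.ext
  simp [hermAct]

theorem minkAct_add (A : SpecialLinearGroup (Fin 2) ℂ) (p q : Mink) :
    minkAct A (p + q) = minkAct A p + minkAct A q := by
  simp only [minkAct, map_add, hermAct_add]

theorem minkAct_smul (A : SpecialLinearGroup (Fin 2) ℂ) (c : ℝ) (p : Mink) :
    minkAct A (c • p) = c • minkAct A p := by
  simp only [minkAct, map_smul, hermAct_smul]

/-- The action on Minkowski space as a continuous linear map. -/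
def minkActL (A : SpecialLinearGroup (Fin 2) ℂ) : Mink →L[ℝ] Mink :=
  LinearMap.toContinuousLinearMap ⟨⟨minkAct A, minkAct_add A⟩, minkAct_smul A⟩

/-- The quadratic form is four times the determinant, so its invariance under `SL(2, ℂ)` is
multiplicativity of `det`; polarization then gives the bilinear form. -/
theorem mink_g_self (S : Herm) : ((mink (g S) (g S) : ℝ) : ℂ) = 4 * S.1.det := by
  have hS : ∀ m l, star (S.1 l m) = S.1 m l := fun m l => congrFun (congrFun S.2 m) l
  have h0 := congrArg Complex.im (hS 0 0)
  have h1 := congrArg Complex.im (hS 1 1)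
  have h2 := hS 1 0
  simp only [RCLike.star_def, Complex.conj_im] at h0 h1
  have e0 : (S.1 0 0).im = 0 := by linarith
  have e1 : (S.1 1 1).im = 0 := by linarith
  rw [det_fin_two, ← h2]
  apply Complex.ext
  · simp [mink, g, e0, e1]; ring
  · simp [e0, e1]; ring

theorem det_hermAct (A : SpecialLinearGroup (Fin 2) ℂ) (S : Herm) :
    (hermAct A S).1.det = S.1.det := by
  simp [hermAct, det_mul, det_conjTranspose, A.2]

theorem mink_minkAct_self (A : SpecialLinearGroup (Fin 2) ℂ) (p : Mink) :
    mink (minkAct A p) (minkAct A p) = mink p p := by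
  have h1 := mink_g_self (hermAct A (g.symm p))
  have h2 := mink_g_self (g.symm p)
  rw [det_hermAct, ← h2, g.apply_symm_apply] at h1
  exact_mod_cast h1

theorem mink_minkAct (A : SpecialLinearGroup (Fin 2) ℂ) (p q : Mink) :
    mink (minkAct A p) (minkAct A q) = mink p q := by
  have polar : ∀ x y : Mink, mink x y = (mink (x + y) (x + y) - mink x x - mink y y) / 2 := by
    intro x y
    simp only [mink, Pi.add_apply]; ring
  rw [polar, ← minkAct_add, mink_minkAct_self, mink_minkAct_self, mink_minkAct_self, ← polar]

theorem minkAct_mem_hyperboloid (A : SpecialLinearGroup (Fin 2) ℂ) {q : Mink}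
    (hq : q ∈ hyperboloid) : minkAct A q ∈ hyperboloid := by
  have hm := (mink_minkAct_self A q).trans hq.1
  refine ⟨hm, ?_⟩
  have hs := sub_pos_of_mem_hyperboloid hq
  obtain ⟨h1, h0⟩ := hq
  set a := A.1 0 0 with ha
  set b := A.1 0 1 with hb
  -- Half of `T + Z` is the upper left entry of `A S A*`. Multiplied by `q 0 - q 3 > 0`, it becomes
  -- a sum of squares, so the image has `T + Z ≥ 0`. Together with `T ≤ 0` this would contradict `T²
  -- - Z² ≥ 1`.
  have e : (minkAct A q 0 + minkAct A q 3) / 2 =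
      ((q 0 + q 3) / 2) * (a.re ^ 2 + a.im ^ 2) + ((q 0 - q 3) / 2) * (b.re ^ 2 + b.im ^ 2) +
      q 1 * (a.re * b.re + a.im * b.im) - q 2 * (a.im * b.re - a.re * b.im) := by
    simp [minkAct, hermAct, g, Matrix.mul_apply, ← ha, ← hb]
    ring
  have hnn : 0 ≤ minkAct A q 0 + minkAct A q 3 := by
    simp only [mink] at h1
    have e' : (q 0 - q 3) * (minkAct A q 0 + minkAct A q 3) =
        ((q 0 - q 3) * b.re + q 1 * a.re - q 2 * a.im) ^ 2 +
        ((q 0 - q 3) * b.im + q 1 * a.im + q 2 * a.re) ^ 2 + (a.re ^ 2 + a.im ^ 2) := by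
      linear_combination 2 * (q 0 - q 3) * e + (a.re ^ 2 + a.im ^ 2) * h1
    have : 0 ≤ (q 0 - q 3) * (minkAct A q 0 + minkAct A q 3) := by rw [e']; positivity
    exact nonneg_of_mul_nonneg_right this hs
  simp only [mink] at hm
  by_contra! hc
  nlinarith [sq_nonneg (minkAct A q 1), sq_nonneg (minkAct A q 2),
    mul_nonneg hnn (neg_nonneg.2 hc)]

theorem upperAct_eq (A : SpecialLinearGroup (Fin 2) ℂ) {y : E3} (hy : y ∈ upper) :
    upperAct A y = toUpper (minkAct A (ofUpper y)) := by
  rw [upperAct, discAct, iInv_jInv hy,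
    j_i (minkAct_mem_hyperboloid A (ofUpper_mem_hyperboloid hy))]

theorem upperAct_toUpper (A : SpecialLinearGroup (Fin 2) ℂ) {q : Mink} (hq : q ∈ hyperboloid) :
    upperAct A (toUpper q) = toUpper (minkAct A q) := by
  rw [upperAct_eq A (toUpper_mem_upper hq), ofUpper_toUpper hq]

theorem differentiableAt_upperAct (A : SpecialLinearGroup (Fin 2) ℂ) {y : E3} (hy : y ∈ upper) :
    DifferentiableAt ℝ (upperAct A) y := by
  have hopen : IsOpen upper := isOpen_lt continuous_const (by fun_prop)
  have h1 : DifferentiableAt ℝ (fun x => toUpper (minkActL A (ofUpper x))) y :=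
    DifferentiableAt.comp y (g := toUpper)
      (differentiableAt_toUpper (minkAct_mem_hyperboloid A (ofUpper_mem_hyperboloid hy)))
      ((minkActL A).differentiableAt.comp y (differentiableAt_ofUpper hy))
  refine h1.congr_of_eventuallyEq ?_
  filter_upwards [hopen.mem_nhds hy] with x hx using upperAct_eq A hx

theorem fderiv_upperAct (A : SpecialLinearGroup (Fin 2) ℂ) {M : Set Mink} {q u : Mink}
    (hM : M ⊆ hyperboloid) (hq : q ∈ hyperboloid) (hu : u ∈ tangentVectors M q) :
    fderiv ℝ (upperAct A) (toUpper q) (toUpperDeriv q u) =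
      toUpperDeriv (minkAct A q) (minkAct A u) := by
  obtain ⟨γ, rfl, hm, hd⟩ := hu
  have h1 := (differentiableAt_upperAct A (toUpper_mem_upper hq)).hasFDerivAt.comp_hasDerivAt 0
    (hasDerivAt_toUpper hd hq)
  have h2 := hasDerivAt_toUpper ((minkActL A).hasFDerivAt.comp_hasDerivAt 0 hd)
    (minkAct_mem_hyperboloid A hq)
  refine h1.unique (h2.congr_of_eventuallyEq ?_)
  exact hm.mono fun t ht => upperAct_toUpper A (hM ht)

/-! ### Spinors -/

theorem minkAct_g_f (A : SpecialLinearGroup (Fin 2) ℂ) (κ : Fin 2 → ℂ) :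
    minkAct A (g (f κ)) = g (f (A.1 *ᵥ κ)) := by
  rw [minkAct, g.symm_apply_apply]
  congr 1
  apply Subtype.ext
  simp only [hermAct, f]
  rw [mul_vecMulVec, vecMulVec_mul, star_mulVec]

theorem minkAct_g_lineDeriv (A : SpecialLinearGroup (Fin 2) ℂ) (κ ν : Fin 2 → ℂ) :
    minkAct A (g (lineDeriv ℝ f κ ν)) = g (lineDeriv ℝ f (A.1 *ᵥ κ) (A.1 *ᵥ ν)) := by
  rw [minkAct, g.symm_apply_apply]
  congr 1
  apply Subtype.ext
  simp only [hermAct, lineDeriv_f]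
  rw [Matrix.mul_add, Matrix.add_mul, mul_vecMulVec, mul_vecMulVec, vecMulVec_mul, vecMulVec_mul,
    star_mulVec, star_mulVec]

/-- Translates orthogonality of null vectors into linear dependence of spinors. -/
theorem mink_g_f (κ ν : Fin 2 → ℂ) :
    mink (g (f κ)) (g (f ν)) = 2 * Complex.normSq (κ 0 * ν 1 - κ 1 * ν 0) := by
  simp [mink, g, f, vecMulVec_apply, Complex.normSq_apply]
  ring

theorem f_smul_of_eq_one_or_neg_one {ε : ℂ} (hε : ε = 1 ∨ ε = -1) (κ : Fin 2 → ℂ) :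
    f (ε • κ) = f κ := by
  apply Subtype.ext
  ext m l
  rcases hε with rfl | rfl <;> simp [f, vecMulVec_apply]

/-- The tangent vector of the flag of a spinor, in Minkowski space. -/
def flagVec (κ : Fin 2 → ℂ) : Mink := g (lineDeriv ℝ f κ (Z κ))

theorem flagVec_eq (κ : Fin 2 → ℂ) :
    flagVec κ = ![0, 2 * (Complex.I * (κ 0 ^ 2 + star (κ 1) ^ 2)).re,
      2 * (Complex.I * (κ 0 ^ 2 + star (κ 1) ^ 2)).im, 4 * (κ 0 * κ 1).im] := by
  have z0 : Z κ 0 = Complex.I * star (κ 1) := rfl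
  have z1 : Z κ 1 = -Complex.I * star (κ 0) := rfl
  ext m
  fin_cases m <;> simp [flagVec, g, lineDeriv_f, vecMulVec_apply, z0, z1, pow_two] <;> ring

theorem g_f_eq (κ : Fin 2 → ℂ) :
    g (f κ) = ![Complex.normSq (κ 0) + Complex.normSq (κ 1), 2 * (κ 0 * star (κ 1)).re,
      2 * (κ 0 * star (κ 1)).im, Complex.normSq (κ 0) - Complex.normSq (κ 1)] := by
  ext m
  fin_cases m <;> simp [g, f, vecMulVec_apply, Complex.normSq_apply]

theorem g_f_mem_lightCone {κ : Fin 2 → ℂ} (hκ : κ ≠ 0) : g (f κ) ∈ lightCone :=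
  g_mem_lightCone (f_mem_hermCone hκ)

theorem mink_flagVec_g_f (κ : Fin 2 → ℂ) : mink (flagVec κ) (g (f κ)) = 0 := by
  rw [flagVec_eq, g_f_eq]
  simp [mink, Complex.normSq_apply, pow_two]
  ring

theorem mink_flagVec_self (κ : Fin 2 → ℂ) :
    mink (flagVec κ) (flagVec κ) = -(2 * (Complex.normSq (κ 0) + Complex.normSq (κ 1))) ^ 2 := by
  rw [flagVec_eq]
  simp [mink, Complex.normSq_apply, pow_two]
  ring

theorem normSq_add_pos {κ : Fin 2 → ℂ} (hκ : κ ≠ 0) :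
    0 < Complex.normSq (κ 0) + Complex.normSq (κ 1) := by
  have := (g_f_mem_lightCone hκ).2
  rwa [g_f_eq] at this

/-- The vector which directs the line of the flag of `κ` at the point `q` of its horosphere. -/
def horoVec (κ : Fin 2 → ℂ) (q : Mink) : Mink := flagVec κ - mink (flagVec κ) q • g (f κ)

theorem mink_horoVec {κ : Fin 2 → ℂ} (hκ : κ ≠ 0) {q : Mink} (hq : q ∈ h (g (f κ))) :
    mink (horoVec κ q) q = 0 ∧ mink (horoVec κ q) (g (f κ)) = 0 := by
  have h1 := (g_f_mem_lightCone hκ).1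
  have h2 := hq.2
  rw [mink_comm] at h2
  constructor
  · rw [horoVec, mink_sub_left, mink_smul_left, h2]; ring
  · rw [horoVec, mink_sub_left, mink_smul_left, h1, mink_flagVec_g_f]; ring

theorem horoVec_mem_tangentVectors {κ : Fin 2 → ℂ} (hκ : κ ≠ 0) {q : Mink}
    (hq : q ∈ h (g (f κ))) : horoVec κ q ∈ tangentVectors (h (g (f κ))) q :=
  (mem_tangentVectors_h_iff (g_f_mem_lightCone hκ) hq).2 (mink_horoVec hκ hq)

/-- Subtracting a multiple of the null vector `g (f κ)`, which is orthogonal to `flagVec κ`, does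
not change the square. -/
theorem mink_horoVec_self_ne_zero {κ : Fin 2 → ℂ} (hκ : κ ≠ 0) {q : Mink}
    (hq : q ∈ h (g (f κ))) : mink (horoVec κ q) (horoVec κ q) ≠ 0 := by
  have e : mink (horoVec κ q) (horoVec κ q) = mink (flagVec κ) (flagVec κ) := by
    nth_rewrite 1 [horoVec]
    rw [mink_sub_left, mink_smul_left, mink_comm (g (f κ)), (mink_horoVec hκ hq).2,
      mink_comm, horoVec, mink_sub_left, mink_smul_left, mink_comm (g (f κ)), mink_flagVec_g_f]
    ring
  rw [e, mink_flagVec_self]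
  have := normSq_add_pos hκ
  exact neg_ne_zero.2 (by positivity)

theorem horoVec_ne_zero {κ : Fin 2 → ℂ} (hκ : κ ≠ 0) {q : Mink} (hq : q ∈ h (g (f κ))) :
    horoVec κ q ≠ 0 := fun h0 => mink_horoVec_self_ne_zero hκ hq (by simp [h0, mink])

/-- Orthogonality to `q` determines the coefficient of `g (f κ)` from that of `flagVec κ`, and the
orientation of the flag says that the latter is positive. -/
theorem dir_H_G_F {κ : Fin 2 → ℂ} (hκ : κ ≠ 0) {q : Mink} (hq : q ∈ h (g (f κ))) :
    (H (G (F κ hκ))).dir q = {w | ∃ b : ℝ, 0 < b ∧ w = b • horoVec κ q} := by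
  have hqp : mink (g (f κ)) q = 1 := by rw [mink_comm]; exact hq.2
  ext w
  constructor
  · rintro ⟨-, -, ht, _, ⟨a, b, hb, rfl⟩, rfl⟩
    have e := (mink_eq_zero_of_mem_tangentVectors_h ht).1
    rw [map_add, map_smul, map_smul] at e ⊢
    change mink (a • g (f κ) + b • flagVec κ) q = 0 at e
    change ∃ b' : ℝ, 0 < b' ∧ a • g (f κ) + b • flagVec κ = b' • horoVec κ q
    refine ⟨b, hb, ?_⟩
    rw [mink_add_left, mink_smul_left, mink_smul_left, hqp] at e
    have ha : a = -(b * mink (flagVec κ) q) := by linarith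
    rw [ha, horoVec, smul_sub, smul_smul, neg_smul]
    abel
  · rintro ⟨b, hb, rfl⟩
    have hmem : b • horoVec κ q =
        g ((-(b * mink (flagVec κ) q)) • f κ + b • lineDeriv ℝ f κ (Z κ)) := by
      rw [map_add, map_smul, map_smul]
      change _ = _ + b • flagVec κ
      rw [horoVec, smul_sub, smul_smul, neg_smul]
      abel
    refine ⟨hq, ?_, ?_, ?_⟩
    · rw [hmem]
      refine Submodule.mem_map_of_mem (Submodule.add_mem _ (Submodule.smul_mem _ _ ?_)
        (Submodule.smul_mem _ _ ?_))
      · exact Submodule.subset_span (by simp)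
      · exact Submodule.subset_span (by simp)
    · refine (mem_tangentVectors_h_iff (g_f_mem_lightCone hκ) hq).2 ?_
      rw [mink_smul_left, mink_smul_left, (mink_horoVec hκ hq).1, (mink_horoVec hκ hq).2]
      simp
    · rw [hmem]
      exact ⟨_, ⟨_, b, hb, rfl⟩, rfl⟩

/-! ### The decorated horosphere of a spinor -/

theorem k_eq (κ : Fin 2 → ℂ) : k κ = toUpper '' h (g (f κ)) := by
  rw [k, Set.image_image]
  exact Set.image_congr fun q hq => j_i hq.1

theorem carrier_K (κ : Fin 2 → ℂ) (hκ : κ ≠ 0) : (K κ hκ).carrier = toUpper '' h (g (f κ)) :=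
  k_eq κ

theorem dir_K {κ : Fin 2 → ℂ} (hκ : κ ≠ 0) (y : E3) :
    (K κ hκ).dir y = {w | ∃ q ∈ h (g (f κ)), toUpper q = y ∧
      ∃ b : ℝ, 0 < b ∧ w = b • toUpperDeriv q (horoVec κ q)} := by
  have key : ∀ q ∈ h (g (f κ)), ∀ b : ℝ, fderiv ℝ j (i q) (fderiv ℝ i q (b • horoVec κ q)) =
      b • toUpperDeriv q (horoVec κ q) := fun q hq b => by
    rw [map_smul, map_smul,
      fderiv_j_fderiv_i (fun x hx => hx.1) hq.1 (horoVec_mem_tangentVectors hκ hq)]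
  ext w
  constructor
  · rintro ⟨x, -, rfl, v, ⟨q, hq, rfl, u, hu, rfl⟩, rfl⟩
    rw [dir_H_G_F hκ hq] at hu
    obtain ⟨b, hb, rfl⟩ := hu
    exact ⟨q, hq, (j_i hq.1).symm, b, hb, key q hq b⟩
  · rintro ⟨q, hq, rfl, b, hb, rfl⟩
    refine ⟨i q, ⟨q, hq, rfl⟩, j_i hq.1, _, ⟨q, hq, rfl, b • horoVec κ q, ?_, rfl⟩,
      (key q hq b).symm⟩
    rw [dir_H_G_F hκ hq]
    exact ⟨b, hb, rfl⟩

theorem dir_K_toUpper {κ : Fin 2 → ℂ} (hκ : κ ≠ 0) {q : Mink} (hq : q ∈ h (g (f κ))) :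
    (K κ hκ).dir (toUpper q) =
      {w | ∃ b : ℝ, 0 < b ∧ w = b • toUpperDeriv q (horoVec κ q)} := by
  rw [dir_K]
  ext w
  constructor
  · rintro ⟨q', hq', e, hw⟩
    obtain rfl := injOn_toUpper hq'.1 hq.1 e
    exact hw
  · exact fun hw => ⟨q, hq, rfl, hw⟩

theorem isOrientedLineField_K {κ : Fin 2 → ℂ} (hκ : κ ≠ 0) :
    (K κ hκ).IsOrientedLineField := by
  rw [DirectedSet.IsOrientedLineField, carrier_K]
  constructor
  · rintro _ ⟨q, hq, rfl⟩
    have ht := horoVec_mem_tangentVectors hκ hq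
    refine ⟨_, ?_, toUpperDeriv_ne_zero (fun x hx => hx.1) hq.1 ht (horoVec_ne_zero hκ hq),
      dir_K_toUpper hκ hq⟩
    obtain ⟨γ, h0, hm, hd⟩ := ht
    refine ⟨fun t => toUpper (γ t), by simp only [h0],
      hm.mono fun t ht => Set.mem_image_of_mem _ ht, ?_⟩
    have := hasDerivAt_toUpper hd (h0 ▸ hq.1)
    rwa [h0] at this
  · intro y hy
    rw [dir_K, Set.eq_empty_iff_forall_notMem]
    rintro w ⟨q, hq, rfl, -⟩
    exact hy ⟨q, hq, rfl⟩

/-- A parabolic element which preserves the horosphere of `κ` fixes `κ` up to sign. -/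
theorem mulVec_eq_of_image_eq {κ : Fin 2 → ℂ} (hκ : κ ≠ 0) {A : SpecialLinearGroup (Fin 2) ℂ}
    (hA : IsParabolic A) (himg : minkAct A '' h (g (f κ)) = h (g (f κ))) :
    ∃ ε : ℂ, (ε = 1 ∨ ε = -1) ∧ A.1 *ᵥ κ = ε • κ := by
  obtain ⟨q, hq⟩ := h_nonempty (g_f_mem_lightCone hκ)
  -- The image of `h p` under `A` lies in `h (A p)`; here that image is `h p` itself.
  have hsub : h (g (f κ)) ⊆ h (g (f (A.1 *ᵥ κ))) := by
    intro x hx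
    obtain ⟨x', hx', rfl⟩ := himg.symm ▸ hx
    refine ⟨hx.1, ?_⟩
    rw [← minkAct_g_f, mink_minkAct, hx'.2]
  have h0 := mink_eq_zero_of_h_subset (g_f_mem_lightCone hκ) hq (mink_horoVec hκ hq).1
    (mink_horoVec hκ hq).2 (mink_horoVec_self_ne_zero hκ hq) hsub
  rw [mink_g_f, mul_eq_zero, Complex.normSq_eq_zero] at h0
  have h0 := h0.resolve_left two_ne_zero
  have hlam : ∃ ε : ℂ, A.1 *ᵥ κ = ε • κ := by
    by_cases hk : κ 0 = 0
    · have hk1 : κ 1 ≠ 0 := fun hk1 => hκ (by ext m; fin_cases m <;> simp [hk, hk1])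
      refine ⟨(A.1 *ᵥ κ) 1 / κ 1, ?_⟩
      rw [hk] at h0
      ext m
      fin_cases m
      · have : (A.1 *ᵥ κ) 0 = 0 := by simpa [hk1] using h0
        simp [this, hk]
      · simp [hk1]
    · refine ⟨(A.1 *ᵥ κ) 0 / κ 0, ?_⟩
      ext m
      fin_cases m
      · simp [hk]
      · simp only [Fin.mk_one, Pi.smul_apply, smul_eq_mul]
        field_simp
        linear_combination h0
  obtain ⟨ε, hε⟩ := hlam
  refine ⟨ε, ?_, hε⟩
  have e0 := congrFun hε 0
  have e1 := congrFun hε 1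
  simp [mulVec, dotProduct, Fin.sum_univ_two] at e0 e1
  have hdet : A.1 0 0 * A.1 1 1 - A.1 0 1 * A.1 1 0 = 1 := by rw [← det_fin_two]; exact A.2
  -- The eigenvalue is a root of the characteristic polynomial, which is `(X ∓ 1)²` when the trace
  -- is `±2`.
  have hchar : ε ^ 2 - A.1.trace * ε + 1 = 0 := by
    rw [trace_fin_two]
    by_cases hk : κ 0 = 0
    · have hk1 : κ 1 ≠ 0 := fun hk1 => hκ (by ext m; fin_cases m <;> simp [hk, hk1])
      refine (mul_eq_zero.1 ?_).resolve_right hk1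
      linear_combination (-κ 1) * hdet - A.1 1 0 * e0 - (ε - A.1 0 0) * e1
    · refine (mul_eq_zero.1 ?_).resolve_right hk
      linear_combination (-κ 0) * hdet - A.1 0 1 * e1 - (ε - A.1 1 1) * e0
  rcases hA with hA | hA <;> rw [hA] at hchar
  · left
    have : (ε - 1) ^ 2 = 0 := by linear_combination hchar
    exact sub_eq_zero.1 (pow_eq_zero_iff two_ne_zero |>.1 this)
  · right
    have : (ε + 1) ^ 2 = 0 := by linear_combination hchar
    exact eq_neg_of_add_eq_zero_left (pow_eq_zero_iff two_ne_zero |>.1 this)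

/-- An element of `SL(2, ℂ)` which fixes `κ` up to sign preserves the flag of `κ`. -/
theorem minkAct_flagVec {κ : Fin 2 → ℂ} (hκ : κ ≠ 0) {A : SpecialLinearGroup (Fin 2) ℂ} {ε : ℂ}
    (hε : ε = 1 ∨ ε = -1) (hA : A.1 *ᵥ κ = ε • κ) :
    ∃ r : ℝ, minkAct A (flagVec κ) = flagVec κ + r • g (f κ) := by
  have hε2 : ε * ε = 1 := by rcases hε with rfl | rfl <;> simp
  have e0 := congrFun hA 0
  have e1 := congrFun hA 1
  simp [mulVec, dotProduct, Fin.sum_univ_two] at e0 e1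
  have hdet : A.1 0 0 * A.1 1 1 - A.1 0 1 * A.1 1 0 = 1 := by rw [← det_fin_two]; exact A.2
  set u := A.1 *ᵥ Z κ with hu
  have hu0 : u 0 = A.1 0 0 * Z κ 0 + A.1 0 1 * Z κ 1 := by
    simp [hu]
  have hu1 : u 1 = A.1 1 0 * Z κ 0 + A.1 1 1 * Z κ 1 := by
    simp [hu]
  -- This is `det (A κ, A (Z κ)) = det (κ, Z κ)`. As `ε² = 1`, it says that `ε u - Z κ` is
  -- proportional to `κ`.
  have hcross : ε * (κ 0 * u 1 - κ 1 * u 0) = κ 0 * Z κ 1 - κ 1 * Z κ 0 := by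
    linear_combination (κ 0 * Z κ 1 - κ 1 * Z κ 0) * hdet - u 1 * e0 + u 0 * e1
      + (A.1 0 0 * κ 0 + A.1 0 1 * κ 1) * hu1 - (A.1 1 0 * κ 0 + A.1 1 1 * κ 1) * hu0
  have hc : ∃ c : ℂ, u = ε • (Z κ + c • κ) := by
    by_cases hk : κ 0 = 0
    · have hk1 : κ 1 ≠ 0 := fun hk1 => hκ (by ext m; fin_cases m <;> simp [hk, hk1])
      refine ⟨(ε * u 1 - Z κ 1) / κ 1, ?_⟩
      ext m
      fin_cases m
      · simp only [Fin.zero_eta, Pi.smul_apply, Pi.add_apply, smul_eq_mul]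
        rw [hk] at hcross ⊢
        refine mul_left_cancel₀ hk1 ?_
        linear_combination (-κ 1 * u 0) * hε2 - ε * hcross
      · simp only [Fin.mk_one, Pi.smul_apply, Pi.add_apply, smul_eq_mul]
        field_simp
        linear_combination (-u 1) * hε2
    · refine ⟨(ε * u 0 - Z κ 0) / κ 0, ?_⟩
      ext m
      fin_cases m
      · simp only [Fin.zero_eta, Pi.smul_apply, Pi.add_apply, smul_eq_mul]
        field_simp
        linear_combination (-u 0) * hε2
      · simp only [Fin.mk_one, Pi.smul_apply, Pi.add_apply, smul_eq_mul]
        field_simp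
        linear_combination ε * hcross - κ 0 * u 1 * hε2
  obtain ⟨c, hc⟩ := hc
  -- The two signs `ε` cancel, and the derivative of `f` at `κ` in the direction `c κ` is `(c + c̄)
  -- f κ`.
  refine ⟨2 * c.re, ?_⟩
  rw [flagVec, minkAct_g_lineDeriv, ← hu, hc, hA, ← map_smul, ← map_add]
  congr 1
  apply Subtype.ext
  rw [Submodule.coe_add, Submodule.coe_smul, lineDeriv_f, lineDeriv_f]
  have hcc : ((2 * c.re : ℝ) : ℂ) = c + star c := by
    apply Complex.ext <;> simp; ring
  have hεs : star ε = ε := by rcases hε with rfl | rfl <;> simp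
  ext m l
  simp only [f, Matrix.add_apply, Matrix.smul_apply, vecMulVec_apply, Pi.star_apply, Pi.smul_apply,
    Pi.add_apply, smul_eq_mul, star_mul', star_add, Complex.real_smul, hcc, hεs]
  linear_combination (κ m * (star (Z κ l) + star c * star (κ l)) +
    (Z κ m + c * κ m) * star (κ l)) * hε2

theorem isParallel_K {κ : Fin 2 → ℂ} (hκ : κ ≠ 0) : IsParallel (K κ hκ) := by
  intro A hA himg
  have himg' : minkAct A '' h (g (f κ)) = h (g (f κ)) := by
    rw [carrier_K, Set.image_image] at himg
    rw [Set.image_congr (fun q (hq : q ∈ h (g (f κ))) => upperAct_toUpper A hq.1),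
      ← Set.image_image toUpper (minkAct A)] at himg
    refine (injOn_toUpper.image_eq_image_iff ?_ ?_).1 himg
    · rintro _ ⟨q, hq, rfl⟩
      exact minkAct_mem_hyperboloid A hq.1
    · exact fun q hq => hq.1
  obtain ⟨ε, hε, hAκ⟩ := mulVec_eq_of_image_eq hκ hA himg'
  obtain ⟨r, hr⟩ := minkAct_flagVec hκ hε hAκ
  have hp : minkAct A (g (f κ)) = g (f κ) := by
    rw [minkAct_g_f, hAκ, f_smul_of_eq_one_or_neg_one hε]
  have hvec : ∀ q ∈ h (g (f κ)), minkAct A (horoVec κ q) = horoVec κ (minkAct A q) := by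
    intro q hq
    have e1 : mink (g (f κ)) (minkAct A q) = 1 := by
      conv_lhs => rw [← hp]
      rw [mink_minkAct, mink_comm, hq.2]
    have e2 := mink_minkAct A (flagVec κ) q
    rw [hr, mink_add_left, mink_smul_left, e1] at e2
    -- The shift by `r` in this coefficient absorbs the term `r • g (f κ)` of `A v`.
    have e3 : mink (flagVec κ) (minkAct A q) = mink (flagVec κ) q - r := by linarith
    rw [horoVec, horoVec, e3, sub_eq_add_neg, ← neg_smul, minkAct_add, minkAct_smul, hr, hp,
      neg_smul, sub_smul]
    abel
  have hder : ∀ q ∈ h (g (f κ)), ∀ b : ℝ,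
      fderiv ℝ (upperAct A) (toUpper q) (b • toUpperDeriv q (horoVec κ q)) =
        b • toUpperDeriv (minkAct A q) (horoVec κ (minkAct A q)) := by
    intro q hq b
    rw [map_smul, fderiv_upperAct A (fun x hx => hx.1) hq.1 (horoVec_mem_tangentVectors hκ hq),
      hvec q hq]
  ext1
  · exact himg
  · funext y
    ext w
    constructor
    · rintro ⟨x, hx, rfl, v, hv, rfl⟩
      rw [carrier_K] at hx
      obtain ⟨q, hq, rfl⟩ := hx
      rw [dir_K_toUpper hκ hq] at hv
      obtain ⟨b, hb, rfl⟩ := hv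
      have hAq : minkAct A q ∈ h (g (f κ)) := himg' ▸ Set.mem_image_of_mem _ hq
      rw [upperAct_toUpper A hq.1, dir_K_toUpper hκ hAq, hder q hq]
      exact ⟨b, hb, rfl⟩
    · intro hw
      rw [dir_K] at hw
      obtain ⟨q, hq, rfl, b, hb, rfl⟩ := hw
      obtain ⟨q, hq', rfl⟩ := himg'.symm ▸ hq
      refine ⟨toUpper q, ?_, upperAct_toUpper A hq'.1, b • toUpperDeriv q (horoVec κ q), ?_,
        (hder q hq' b).symm⟩
      · rw [carrier_K]
        exact Set.mem_image_of_mem _ hq'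
      · rw [dir_K_toUpper hκ hq']
        exact ⟨b, hb, rfl⟩

theorem isDecoratedHorosphere_K {κ : Fin 2 → ℂ} (hκ : κ ≠ 0) : IsDecoratedHorosphere (K κ hκ) :=
  ⟨⟨_, isHorosphereHyp_h (g_f_mem_lightCone hκ), rfl⟩, isOrientedLineField_K hκ, isParallel_K hκ⟩

/-! ### Explicit description in the upper half space -/

theorem mem_toUpper_image_h_iff {p : Mink} {y : E3} :
    y ∈ toUpper '' h p ↔ y ∈ upper ∧ mink (ofUpper y) p = 1 := by
  constructor
  · rintro ⟨q, hq, rfl⟩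
    refine ⟨toUpper_mem_upper hq.1, ?_⟩
    rw [ofUpper_toUpper hq.1, hq.2]
  · rintro ⟨hy, h1⟩
    exact ⟨ofUpper y, ⟨ofUpper_mem_hyperboloid hy, h1⟩, toUpper_ofUpper hy⟩

theorem mem_carrier_K_iff {κ : Fin 2 → ℂ} (hκ : κ ≠ 0) {y : E3} :
    y ∈ (K κ hκ).carrier ↔ y ∈ upper ∧
      Complex.normSq (κ 0 - κ 1 * ⟨y 0, y 1⟩) + Complex.normSq (κ 1) * y 2 ^ 2 = y 2 := by
  rw [carrier_K, mem_toUpper_image_h_iff]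
  refine and_congr_right fun hy => ?_
  have hy : 0 < y 2 := hy
  have e : mink (ofUpper y) (g (f κ)) =
      (Complex.normSq (κ 0 - κ 1 * ⟨y 0, y 1⟩) + Complex.normSq (κ 1) * y 2 ^ 2) / y 2 := by
    rw [g_f_eq]
    simp [mink, ofUpper, Complex.normSq_apply]
    field_simp
    ring
  rw [e, div_eq_one_iff_eq hy.ne']

theorem isCentre_K (ξ η : ℂ) (hκ : ![ξ, η] ≠ 0) :
    IsCentre (K ![ξ, η] hκ).carrier
      (if η = 0 then OnePoint.infty else ((ξ / η : ℂ) : OnePoint ℂ)) := by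
  have hp := g_f_mem_lightCone hκ
  refine ⟨_, _, isCentreHyp_h hp, rfl, ?_⟩
  have hpos := normSq_add_pos hκ
  have hg := g_f_eq ![ξ, η]
  simp only [cons_val_zero, cons_val_one] at hpos hg
  have e0 : g (f ![ξ, η]) 0 = Complex.normSq ξ + Complex.normSq η := by rw [hg]; rfl
  have e1 : g (f ![ξ, η]) 1 = 2 * (ξ * star η).re := by rw [hg]; rfl
  have e2 : g (f ![ξ, η]) 2 = 2 * (ξ * star η).im := by rw [hg]; rfl
  have e3 : g (f ![ξ, η]) 3 = Complex.normSq ξ - Complex.normSq η := by rw [hg]; rfl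
  by_cases hη : η = 0
  · subst hη
    have : iBdry (g (f ![ξ, 0])) = !₂[0, 0, 1] := by
      simp only [map_zero, add_zero] at hpos e0
      ext m
      fin_cases m <;> simp [iBdry, e0, e1, e2, e3]
      intro h0
      simp [h0] at hpos
    rw [jBdry, if_pos this, if_pos rfl]
  · have hN := Complex.normSq_pos.2 hη
    have hne : iBdry (g (f ![ξ, η])) ≠ !₂[0, 0, 1] := by
      -- A third coordinate equal to `1` would mean `|ξ|² - |η|² = |ξ|² + |η|²`.
      intro h0
      have h2 := congrFun (congrArg WithLp.ofLp h0) 2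
      simp [iBdry, e0, e3] at h2
      field_simp at h2
      linarith
    rw [jBdry, if_neg hne, if_neg hη]
    congr 1
    have i0 : iBdry (g (f ![ξ, η])) 0 =
        2 * (ξ * star η).re / (Complex.normSq ξ + Complex.normSq η) := by
      rw [← e0, ← e1]; rfl
    have i1 : iBdry (g (f ![ξ, η])) 1 =
        2 * (ξ * star η).im / (Complex.normSq ξ + Complex.normSq η) := by
      rw [← e0, ← e2]; rfl
    have i2 : iBdry (g (f ![ξ, η])) 2 =
        (Complex.normSq ξ - Complex.normSq η) / (Complex.normSq ξ + Complex.normSq η) := by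
      rw [← e0, ← e3]; rfl
    rw [i0, i1, i2]
    have hD : ((Complex.normSq ξ : ℂ) + Complex.normSq η) ≠ 0 := by exact_mod_cast hpos.ne'
    have hden : (1 : ℂ) - (((Complex.normSq ξ - Complex.normSq η) /
        (Complex.normSq ξ + Complex.normSq η) : ℝ) : ℂ) =
        2 * (η * star η) / (Complex.normSq ξ + Complex.normSq η) := by
      have : η * star η = Complex.normSq η := Complex.mul_conj η
      rw [this]
      push_cast
      field_simp
      ring
    have hnum : ((2 * (ξ * star η).re / (Complex.normSq ξ + Complex.normSq η) : ℝ) : ℂ) +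
        Complex.I * ((2 * (ξ * star η).im / (Complex.normSq ξ + Complex.normSq η) : ℝ) : ℂ) =
        2 * (ξ * star η) / (Complex.normSq ξ + Complex.normSq η) := by
      conv_rhs => rw [← Complex.re_add_im (ξ * star η)]
      push_cast
      ring
    rw [hnum, hden]
    have hs : star η ≠ 0 := star_ne_zero.2 hη
    field_simp

theorem carrier_K_of_ne_zero {ξ η : ℂ} (hκ : ![ξ, η] ≠ 0) (hη : η ≠ 0) :
    (K ![ξ, η] hκ).carrier =
      Metric.sphere !₂[(ξ / η).re, (ξ / η).im, ‖η‖ ^ (-2 : ℤ) / 2] (‖η‖ ^ (-2 : ℤ) / 2) ∩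
        upper := by
  ext y
  rw [mem_carrier_K_iff, Set.inter_comm, Set.mem_inter_iff]
  refine and_congr_right fun hy => ?_
  simp only [cons_val_zero, cons_val_one]
  have hN := Complex.normSq_pos.2 hη
  have hr : ‖η‖ ^ (-2 : ℤ) = (Complex.normSq η)⁻¹ := by
    rw [Complex.normSq_eq_norm_sq, _root_.zpow_neg]; rfl
  rw [hr]
  set N := Complex.normSq η with hNdef
  have e1 : Complex.normSq (ξ - η * ⟨y 0, y 1⟩) =
      N * (((ξ / η).re - y 0) ^ 2 + ((ξ / η).im - y 1) ^ 2) := by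
    have : ξ - η * ⟨y 0, y 1⟩ = η * (ξ / η - ⟨y 0, y 1⟩) := by field_simp
    rw [this, map_mul, Complex.normSq_apply (_ - _)]
    simp only [Complex.sub_re, Complex.sub_im]
    ring
  rw [Metric.mem_sphere, dist_eq_norm, ← sq_eq_sq₀ (norm_nonneg _) (by positivity), norm_sq_E3, e1]
  simp only [PiLp.sub_apply]
  simp
  rw [← sub_eq_zero, ← @sub_eq_zero _ _ _ ((N⁻¹ / 2) ^ 2)]
  -- Completing the square in the height.
  have e2 : N * ((((ξ / η).re - y 0) ^ 2 + ((ξ / η).im - y 1) ^ 2)) + N * y 2 ^ 2 - y 2 =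
      N * ((y 0 - (ξ / η).re) ^ 2 + (y 1 - (ξ / η).im) ^ 2 + (y 2 - N⁻¹ / 2) ^ 2 -
        (N⁻¹ / 2) ^ 2) := by
    field_simp
    ring
  rw [e2, mul_eq_zero, or_iff_right hN.ne']

theorem carrier_K_of_eq_zero {ξ : ℂ} (hκ : ![ξ, 0] ≠ 0) :
    (K ![ξ, 0] hκ).carrier = {x | x 2 = ‖ξ‖ ^ 2} := by
  ext y
  have hpos := normSq_add_pos hκ
  simp only [cons_val_zero, cons_val_one, map_zero, add_zero] at hpos
  rw [mem_carrier_K_iff]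
  simp only [cons_val_zero, cons_val_one, zero_mul, sub_zero, map_zero, add_zero,
    Complex.normSq_eq_norm_sq, Set.mem_ofPred_eq] at hpos ⊢
  refine ⟨fun hy => hy.2.symm, fun hy => ⟨?_, hy.symm⟩⟩
  change 0 < y 2
  rwa [hy]

theorem isSpecification_K {ξ : ℂ} (hκ : ![ξ, 0] ≠ 0) :
    IsSpecification (K ![ξ, 0] hκ) (Complex.I * ξ ^ 2) := by
  intro y hy
  rw [carrier_K] at hy
  obtain ⟨q, hq, rfl⟩ := hy
  rw [dir_K_toUpper hκ hq]
  have hs := sub_pos_of_mem_hyperboloid hq.1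
  -- Here `g (f κ)` points along `(1, 0, 0, 1)`, which `toUpperDeriv q` annihilates, so the
  -- coefficient `m` plays no role. What remains is `2 I ξ² / (q 0 - q 3)`.
  refine ⟨(q 0 - q 3) / 2, by positivity, ?_⟩
  rw [horoVec]
  set m := mink (flagVec ![ξ, 0]) q
  rw [flagVec_eq, g_f_eq]
  have hs' := hs.ne'
  ext l
  fin_cases l <;> simp [horizontal, toUpperDeriv] <;> field_simp

theorem toUpperDeriv_ofUpper {y : E3} (hy : y ∈ upper) (u : Mink) :
    toUpperDeriv (ofUpper y) u = !₂[(u 1 - y 0 * (u 0 - u 3)) * y 2,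
      (u 2 - y 1 * (u 0 - u 3)) * y 2, -(u 0 - u 3) * y 2 ^ 2] := by
  have hy : 0 < y 2 := hy
  have e : ofUpper y 0 - ofUpper y 3 = 1 / y 2 := by
    simp [ofUpper]
    field_simp
    ring
  have e1 : ofUpper y 1 = y 0 / y 2 := rfl
  have e2 : ofUpper y 2 = y 1 / y 2 := rfl
  rw [toUpperDeriv, e, e1, e2]
  ext m
  fin_cases m <;> simp <;> field_simp

theorem isNorthPoleSpecification_K {ξ η : ℂ} (hκ : ![ξ, η] ≠ 0) (hη : η ≠ 0) :
    IsNorthPoleSpecification (K ![ξ, η] hκ) (Complex.I * η ^ (-2 : ℤ)) := by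
  have hN := Complex.normSq_pos.2 hη
  obtain ⟨s, rfl⟩ : ∃ s, ξ = s * η := ⟨ξ / η, by field_simp⟩
  set n : E3 := !₂[s.re, s.im, (Complex.normSq η)⁻¹] with hn
  have n0 : n 0 = s.re := rfl
  have n1 : n 1 = s.im := rfl
  have n2 : n 2 = (Complex.normSq η)⁻¹ := rfl
  have hnU : n ∈ upper := inv_pos.2 hN
  have hnK : n ∈ (K ![s * η, η] hκ).carrier := by
    rw [mem_carrier_K_iff]
    refine ⟨hnU, ?_⟩
    simp only [cons_val_zero, cons_val_one]
    rw [n0, n1, n2, Complex.eta, mul_comm η s, sub_self, map_zero]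
    field_simp
    ring
  refine ⟨n, ⟨hnK, ?_⟩, ?_⟩
  · intro y hy hne
    rw [mem_carrier_K_iff] at hy
    obtain ⟨hyU, hy⟩ := hy
    have hyU : 0 < y 2 := hyU
    simp only [cons_val_zero, cons_val_one] at hy
    have e : s * η - η * ⟨y 0, y 1⟩ = η * (s - ⟨y 0, y 1⟩) := by ring
    rw [e, map_mul] at hy
    -- With `N = |η|²` and `w` the horizontal position, `N |s - w|² + N z² = z` gives `N z ≤ 1`,
    -- with equality only for `w = s`.
    rw [n2, lt_inv_comm₀ hyU hN, lt_inv_comm₀ hN hyU, ← one_div, lt_div_iff₀ hN]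
    by_contra! hc
    have hnn := Complex.normSq_nonneg (s - ⟨y 0, y 1⟩)
    have h0 : Complex.normSq (s - ⟨y 0, y 1⟩) = 0 := by
      refine le_antisymm ?_ hnn
      have : Complex.normSq η * Complex.normSq (s - ⟨y 0, y 1⟩) ≤ 0 := by nlinarith
      exact nonpos_of_mul_nonpos_right this hN
    rw [h0] at hy
    have h2 : y 2 = (Complex.normSq η)⁻¹ := by
      refine eq_inv_of_mul_eq_one_left ?_
      refine mul_right_cancel₀ hyU.ne' ?_
      linear_combination hy
    have h1 := Complex.normSq_eq_zero.1 h0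
    have hre := congrArg Complex.re h1
    have him := congrArg Complex.im h1
    simp at hre him
    apply hne
    ext m
    fin_cases m
    · exact (sub_eq_zero.1 hre).symm
    · exact (sub_eq_zero.1 him).symm
    · exact h2
  · have hq : ofUpper n ∈ h (g (f ![s * η, η])) := by
      rw [carrier_K, mem_toUpper_image_h_iff] at hnK
      exact ⟨ofUpper_mem_hyperboloid hnU, hnK.2⟩
    have hpos := normSq_add_pos hκ
    simp only [cons_val_zero, cons_val_one] at hpos
    rw [← toUpper_ofUpper hnU, dir_K_toUpper hκ hq]
    -- At the north pole the pushed vector is `2 (|ξ|² + |η|²)` times `I η⁻²`; its vertical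
    -- component cancels by `hm`.
    refine ⟨(2 * (Complex.normSq (s * η) + Complex.normSq η))⁻¹, by positivity, ?_⟩
    have hsq : Complex.normSq η = η.re ^ 2 + η.im ^ 2 := by rw [Complex.normSq_apply]; ring
    have hm : mink (flagVec ![s * η, η]) (ofUpper n) =
        -2 * (s * η ^ 2).im / Complex.normSq η := by
      rw [flagVec_eq, ofUpper, n0, n1, n2]
      generalize Complex.normSq η = N at hN hsq
      simp [mink, pow_two]
      field_simp
      rw [hsq]
      ring
    have hinv : η ^ (-2 : ℤ) = (((Complex.normSq η ^ 2)⁻¹ : ℝ) : ℂ) * star η ^ 2 := by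
      have hN' : (Complex.normSq η : ℂ) = η * star η := (Complex.mul_conj η).symm
      have hs : star η ≠ 0 := star_ne_zero.2 hη
      rw [Complex.ofReal_inv, Complex.ofReal_pow, hN', _root_.zpow_neg]
      field_simp
    rw [toUpperDeriv_ofUpper hnU, horoVec, hm, flagVec_eq, g_f_eq, n0, n1, n2,
      eq_inv_smul_iff₀ (by positivity), hinv, map_mul, Complex.normSq_apply s]
    simp only [cons_val_zero, cons_val_one, map_mul, Complex.normSq_apply s]
    generalize Complex.normSq η = N at hN hsq
    ext l
    fin_cases l
    · simp [horizontal, pow_two]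
      field_simp
      rw [hsq]
      ring
    · simp [horizontal, pow_two]
      field_simp
      rw [hsq]
      ring
    · simp [horizontal, pow_two]
      left
      field_simp
      ring

end SpinorHorosphere

end

open SpinorHorosphere in
theorem theorem1p2 (ξ η : ℂ) (hκ : ![ξ, η] ≠ 0) :
    IsDecoratedHorosphere (K ![ξ, η] hκ) ∧
    IsCentre (K ![ξ, η] hκ).carrier
      (if η = 0 then OnePoint.infty else ((ξ / η : ℂ) : OnePoint ℂ)) ∧
    (η ≠ 0 →
      (K ![ξ, η] hκ).carrier =
        Metric.sphere !₂[(ξ / η).re, (ξ / η).im, ‖η‖ ^ (-2 : ℤ) / 2] (‖η‖ ^ (-2 : ℤ) / 2) ∩ upper ∧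
      IsNorthPoleSpecification (K ![ξ, η] hκ) (Complex.I * η ^ (-2 : ℤ))) ∧
    (η = 0 →
      (K ![ξ, η] hκ).carrier = {x | x 2 = ‖ξ‖ ^ 2} ∧
      IsSpecification (K ![ξ, η] hκ) (Complex.I * ξ ^ 2)) ∧
    (K ![ξ, η] hκ).carrier = k ![ξ, η] := by
  refine ⟨isDecoratedHorosphere_K hκ, isCentre_K ξ η hκ,
    fun hη => ⟨carrier_K_of_ne_zero hκ hη, isNorthPoleSpecification_K hκ hη⟩, ?_, rfl⟩
  rintro rfl
  exact ⟨carrier_K_of_eq_zero hκ, isSpecification_K hκ⟩
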